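/- Let $S=\{s_1,\dots,s_d\}$ be a finite alphabet, let $S^{\pm}=\{s_1^{\pm1},\dots,s_d^{\pm1}\}$, let $F_S$ be the free group on $S$ (the reduced words over $S^\pm$), and let $E=\{w_{i,1}=w_{i,2}\}_{i=1}^r$ be a finite system of formal equations between words over $S^{\pm}$. For a positive integer $n$, a word $w$ and $\overline\sigma=(\sigma_1,\dots,\sigma_d)\in\mathrm{Sym}(n)^d$, let $w(\overline\sigma)$ be the permutation obtained by substituting $s_j\mapsto\sigma_j$. Let $$\mathrm{SOL}_E(n)=\{\overline\sigma\in\mathrm{Sym}(n)^d : w_{i,1}(\overline\sigma)=w_{i,2}(\overline\sigma)\text{ for all }i\},$$ $$\mathrm{SOL}_E^{\ge\varepsilon}(n)=\Big\{\overline\sigma\in\mathrm{Sym}(n)^d : \sum_{j=1}^d d^{\mathrm H}(\sigma_j,\tau_j)\ge\varepsilon\text{ for all }\overline\tau\in\mathrm{SOL}_E(n)\Big\},$$ where $d^{\mathrm H}(\sigma,\tau)=\frac1n|\{x\in[n]:\sigma x\ne\tau x\}|$. For a finite $P\subset F_S$ let $N_{\overline\sigma,P}$ be the distribution of the set $\{w\in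 P: w(\overline\sigma)x=x\}$ for $x$ uniform in $[n]$, and let $d_{\mathrm{TV}}$ be the total variation distance, $d_{\mathrm{TV}}(\theta_1,\theta_2)=\frac12\sum_{Y\subseteq P}|\theta_1(Y)-\theta_2(Y)|$. A machine is a randomized algorithm that takes $n\ge1$ and $\overline\sigma\in\mathrm{Sym}(n)^d$ as input, has oracle access to the entries of the $\sigma_j$ and of their inverses, may draw independent uniform elements of finite sets, and halts on every input. It is an $(\varepsilon,q)$-tester for $E$ if, for every $n\ge1$, it accepts every $\overline\sigma\in\mathrm{SOL}_E(n)$ with probability at least $0.99$, rejects every $\overline\sigma\in\mathrm{SOL}_E^{\ge\varepsilon}(n)$ with probability at least $0.99$, and makes at most $q$ queries on every input. The assignment $\varepsilon\mapsto\mathcal M_\varepsilon$ ($\varepsilon>0$) is a family of testers for $E$ if for every $\varepsilon>0$ there is $q=q(\varepsilon)\in\mathbb N$ (not depending on $n$) such that $\mathcal M_\varepsilon$ is an $(\varepsilon,q)$-tester for $E$; the system $E$ is testable if it has a family of testers. For an integer $k\ge1$, a finite $P\subset F_S$ and $\delta>0$, the Local Statistics Matcher $\mathrm{LSM}^E_{k,P,\delta}$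 draws $x_1,\dots,x_k$ uniformly and independently from $[n]$, computes by queries the sets $Y_j=\{w\in P:w(\overline\sigma)x_j=x_j\}$, lets $N_{\mathrm{Emp}}$ be the distribution of $Y_j$ for $j$ uniform in $\{1,\dots,k\}$, and accepts if and only if $\min\{d_{\mathrm{TV}}(N_{\mathrm{Emp}},N_{\overline\tau,P}):\overline\tau\in\mathrm{SOL}_E(n)\}\le\delta$. Then the following conditions are equivalent: 1. $E$ is testable. 2. There are functions $k\colon\mathbb R_{>0}\to\mathbb Z_{\ge1}$, $P$ from $\mathbb R_{>0}$ to the finite subsets of $F_S$, and $\delta\colon\mathbb R_{>0}\to\mathbb R_{>0}$ such that $\varepsilon\mapsto\mathrm{LSM}^E_{k(\varepsilon),P(\varepsilon),\delta(\varepsilon)}$ is a family of testers for $E$ (in particular, each of these is a machine, that is, it is carried out by an algorithm). 3. $E$ is statistically distinguishable: for every $\varepsilon>0$ there are a finite $P\subset F_S$ and $\delta>0$ such that $d_{\mathrm{TV}}(N_{\overline\sigma,P},N_{\overline\tau,P})\ge\delta$ for all $n\ge1$, $\overline\sigma\in\mathrm{SOL}_E(n)$ and $\overline\tau\in\mathrm{SOL}_E^{\ge\varepsilon}(n)$.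 -/

import Mathlib

namespace PermEq

/-! ### Words, systems of equations, solutions -/

/-- Words over `S^±`, `S = {s_1, …, s_d}`, not necessarily reduced: the letter `(j, true)` is `s_j`
and `(j, false)` is its formal inverse (the convention of Mathlib's `FreeGroup`). -/
abbrev Word (d : ℕ) := List (Fin d × Bool)

/-- The free group `F_S`; `w.toWord` is the reduced word of the element `w`. -/
abbrev FS (d : ℕ) := FreeGroup (Fin d)

/-- A finite system of equations: a finite set of formal equations between words. -/
abbrev EqSystem (d : ℕ) := Finset (Word d × Word d)

/-- Tuples of `d` permutations of an `n`-element set. -/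
abbrev PermTuple (d n : ℕ) := Fin d → Equiv.Perm (Fin n)

/-- The value of a letter under the substitution `s_j ↦ σ_j`. -/
def letterEval {d n : ℕ} (σ : PermTuple d n) (l : Fin d × Bool) : Equiv.Perm (Fin n) :=
  if l.2 then σ l.1 else (σ l.1)⁻¹

/-- The permutation `w(σ)`; in a product the rightmost factor acts first. -/
def wordEval {d n : ℕ} (σ : PermTuple d n) (w : Word d) : Equiv.Perm (Fin n) :=
  (w.map (letterEval σ)).prod

/-- The normalized Hamming distance on `Sym(n)`. -/
noncomputable def hamming {n : ℕ} (σ τ : Equiv.Perm (Fin n)) : ℝ :=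
  (1 / (n : ℝ)) * ((Finset.univ.filter fun x => σ x ≠ τ x).card : ℝ)

/-- The set `SOL_E(n)`. -/
def Sol {d : ℕ} (E : EqSystem d) (n : ℕ) : Set (PermTuple d n) :=
  {σ | ∀ e ∈ E, wordEval σ e.1 = wordEval σ e.2}

/-- The set `SOL_E^{≥ ε}(n)`. -/
def SolFar {d : ℕ} (E : EqSystem d) (ε : ℝ) (n : ℕ) : Set (PermTuple d n) :=
  {σ | ∀ τ ∈ Sol E n, ε ≤ ∑ j, hamming (σ j) (τ j)}

/-! ### Local statistics -/

/-- The set `stab_σ(x) ∩ P`. -/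
def stabIn {d n : ℕ} (σ : PermTuple d n) (P : Finset (FS d)) (x : Fin n) : Finset (FS d) :=
  P.filter fun w => wordEval σ w.toWord x = x

/-- The law of `f i` (as a function giving the mass of every value) when `i` is uniform in the
nonempty finite type `ι`. -/
noncomputable def uniformLaw {ι α : Type*} [Fintype ι] [DecidableEq α] (f : ι → α) (a : α) : ℝ :=
  ((Finset.univ.filter fun i => f i = a).card : ℝ) / (Fintype.card ι : ℝ)

/-- The distribution `N_{σ,P}` of `stab_σ(x) ∩ P` for uniform `x`. -/
noncomputable def localStat {d n : ℕ} (σ : PermTuple d n) (P : Finset (FS d)) :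
    Finset (FS d) → ℝ :=
  uniformLaw (stabIn σ P)

/-- Total variation distance of two distributions over the finite set `Ω`. -/
noncomputable def dTV {α : Type*} (Ω : Finset α) (θ₁ θ₂ : α → ℝ) : ℝ :=
  (1 / 2) * ∑ a ∈ Ω, |θ₁ a - θ₂ a|

/-- `E` is statistically distinguishable. -/
def StatisticallyDistinguishable {d : ℕ} (E : EqSystem d) : Prop :=
  ∀ ε : ℝ, 0 < ε → ∃ (P : Finset (FS d)) (δ : ℝ), 0 < δ ∧
    ∀ n : ℕ, 0 < n → ∀ σ ∈ Sol E n, ∀ τ ∈ SolFar E ε n,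
      δ ≤ dTV P.powerset (localStat σ P) (localStat τ P)

/-! ### Randomized oracle machines -/

/-- The behaviour of a randomized oracle machine on inputs in `Sym(n)^d`, as the (well-founded)
tree of its interactions: it halts with a verdict (`true` is "accept"), or draws a uniformly random
element of a nonempty finite set `Fin m`, independently of all earlier draws, or queries the entry
at `x` of the permutation `σ_j` (`pos = true`) or of its inverse (`pos = false`); in the last two
cases it goes on depending on the response. -/
inductive Tree (d n : ℕ) : Type
  | halt (verdict : Bool) : Tree d n
  | sample (m : ℕ) (hm : 0 < m) (next : Fin m → Tree d n) : Tree d n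
  | query (j : Fin d) (pos : Bool) (x : Fin n) (next : Fin n → Tree d n) : Tree d n

namespace Tree

/-- The probability that the run on `σ` ends with the verdict `b`. -/
noncomputable def prob {d n : ℕ} (σ : PermTuple d n) (b : Bool) : Tree d n → ℝ
  | halt v => if v = b then 1 else 0
  | sample m _ next => (∑ i : Fin m, prob σ b (next i)) / (m : ℝ)
  | query j pos x next => prob σ b (next (letterEval σ (j, pos) x))

/-- The largest number of queries made in a run on `σ`, over all outcomes of the random draws. -/
def queryCount {d n : ℕ} (σ : PermTuple d n) : Tree d n → ℕ
  | halt _ => 0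
  | sample m _ next => Finset.univ.sup fun i : Fin m => queryCount σ (next i)
  | query j pos x next => queryCount σ (next (letterEval σ (j, pos) x)) + 1

/-- The next action of a machine: halt with a verdict, draw from `Fin m`, or query. -/
abbrev Action (d : ℕ) := Bool ⊕ (ℕ ⊕ (Fin d × Bool × ℕ))

/-- The action taken after the given sequence of responses (of draws and of queries, in
chronological order). Once the machine has halted, further responses are ignored; after a response
outside the range the value is a dummy. -/
def action {d n : ℕ} : Tree d n → List ℕ → Action d
  | halt v, _ => Sum.inl v
  | sample m _ _, [] => Sum.inr (Sum.inl m)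
  | sample m _ next, a :: l => if h : a < m then action (next ⟨a, h⟩) l else Sum.inl false
  | query j pos x _, [] => Sum.inr (Sum.inr (j, pos, x.val))
  | query _ _ _ next, a :: l => if h : a < n then action (next ⟨a, h⟩) l else Sum.inl false

end Tree

/-- A family of interaction trees, one for each input size `n`. -/
abbrev Machine (d : ℕ) := (n : ℕ) → Tree d n

/-- The family is carried out by an algorithm: some algorithm computes the next action from `n` and
the responses received so far. -/
def Machine.IsAlgorithm {d : ℕ} (M : Machine d) : Prop :=
  Computable fun p : ℕ × List ℕ => (M p.1).action p.2

/-- `M` is an `(ε, q)`-tester for `E`. -/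
structure IsTester {d : ℕ} (E : EqSystem d) (ε : ℝ) (q : ℕ) (M : Machine d) : Prop where
  algorithm : M.IsAlgorithm
  completeness : ∀ n : ℕ, 0 < n → ∀ σ ∈ Sol E n, (0.99 : ℝ) ≤ (M n).prob σ true
  soundness : ∀ n : ℕ, 0 < n → ∀ σ ∈ SolFar E ε n, (0.99 : ℝ) ≤ (M n).prob σ false
  queries : ∀ n : ℕ, 0 < n → ∀ σ : PermTuple d n, (M n).queryCount σ ≤ q

/-- `ε ↦ M ε` is a family of testers for `E` (only `ε > 0` matters). -/
def IsFamilyOfTesters {d : ℕ} (E : EqSystem d) (M : ℝ → Machine d) : Prop :=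
  ∀ ε : ℝ, 0 < ε → ∃ q : ℕ, IsTester E ε q (M ε)

/-- `E` is testable. -/
def Testable {d : ℕ} (E : EqSystem d) : Prop :=
  ∀ ε : ℝ, 0 < ε → ∃ (q : ℕ) (M : Machine d), IsTester E ε q M

/-! ### The Local Statistics Matcher -/

/-- Draw `k` independent uniform elements of `Fin n` and pass the list of them on. -/
def sampleMany {d n : ℕ} (hn : 0 < n) : ℕ → (List (Fin n) → Tree d n) → Tree d n
  | 0, c => c []
  | k + 1, c => .sample n hn fun x => sampleMany hn k fun xs => c (x :: xs)

/-- Compute `w(σ) x` with one query for each letter of `w`, and pass it on. -/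
def queryWord {d n : ℕ} : Word d → Fin n → (Fin n → Tree d n) → Tree d n
  | [], x, c => c x
  | l :: w, x, c => queryWord w x fun y => .query l.1 l.2 y c

/-- Compute the set of those `w` in a list that fix `x`, and pass it on. -/
def queryStab {d n : ℕ} : List (FS d) → Fin n → (Finset (FS d) → Tree d n) → Tree d n
  | [], _, c => c ∅
  | w :: ws, x, c =>
      queryWord w.toWord x fun y =>
        queryStab ws x fun Q => c (if y = x then insert w Q else Q)

/-- Compute `stab_σ(x) ∩ P` for each `x` in a list, and pass the list of these sets on. -/
noncomputable def queryStabs {d n : ℕ} (P : Finset (FS d)) :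
    List (Fin n) → (List (Finset (FS d)) → Tree d n) → Tree d n
  | [], c => c []
  | x :: xs, c => queryStab P.toList x fun Q => queryStabs P xs fun Qs => c (Q :: Qs)

open Classical in
/-- The Local Statistics Matcher for `E` with repetition factor `k`, word set `P` and proximity
parameter `δ`. The minimum of the distances over the finite nonempty set `SOL_E(n)` is at most `δ`
iff one of the distances is. -/
noncomputable def LSM {d : ℕ} (E : EqSystem d) (k : ℕ) (P : Finset (FS d)) (δ : ℝ) : Machine d :=
  fun n =>
    if hn : 0 < n then
      sampleMany hn k fun xs =>
        queryStabs P xs fun Qs =>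
          .halt (decide (∃ τ ∈ Sol E n, dTV P.powerset (uniformLaw Qs.get) (localStat τ P) ≤ δ))
    else .halt false

end PermEq

/-!
The step from testability to statistical distinguishability is where the content lies.

Relabel the input of a tester by a uniformly random bijection `π` from labels to vertices. Solutions
and far tuples stay solutions and far tuples, so the tester has to separate random relabellings of
a solution `σ` from random relabellings of a far tuple `τ`. Reveal `π` only where the run needs it.
The vertex of a label not seen before is uniform among the remaining vertices; a vertex reached
along an edge is either already labelled or gets a uniform remaining label. Running on `σ` and `τ`
in parallel, the two explored parts stay matched as long as each newly drawn pair of vertices has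
stabilizers with the same trace on a large ball of the free group and is not joined to what has
been explored. Hence each query distinguishes the two runs only by the total variation distance of
the local statistics plus `O(1 / n)`: this is `acceptWeight_le_add`, an induction over the tree,
where the two sides are compared type by type with `sum_le_sum_of_types`. It settles all large `n`
(`exists_le_dTV_of_large`). For each of the remaining `n` a finite set of group elements separates
all stabilizers that occur, and two tuples whose stabilizers have the same statistics are conjugate
(`exists_relabel_eq`, by extending an equivariant injection orbit by orbit), whereas a solution is
never conjugate to a far tuple.

Conversely, if the system is distinguishable with gap `δ₀`, the Local Statistics Matcher with
proximity parameter `1 / M ≤ δ₀ / 3` and many samples is a tester: by Chebyshev's inequality the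
empirical law is within `1 / M` of the true one with probability at least `0.99`
(`le_avgList_of_close`). It is an algorithm, in fact a primitive recursive one
(`isAlgorithm_LSM`): the traces of the stabilizers take finitely many values, so the program may
branch over them, and for each outcome of the sampling the verdict is a bounded search through
tables of `2 d` functions on `Fin n`, coded by the base-`n` digits of one number
(`primrec_verdict`). A rational proximity parameter makes the comparison one between integers.
-/

namespace PermEq

/-! ### The action of the free group and relabelling -/

/-- The action of the free group on `Fin n` in which the generators act by the entries of `σ`. -/
noncomputable def act {d n : ℕ} (σ : PermTuple d n) : FS d →* Equiv.Perm (Fin n) :=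
  FreeGroup.lift σ

theorem wordEval_eq_act {d n : ℕ} (σ : PermTuple d n) (w : Word d) :
    wordEval σ w = act σ (FreeGroup.mk w) := by
  rw [act, FreeGroup.lift_mk, wordEval]
  congr 2
  funext l
  rcases l with ⟨j, _ | _⟩ <;> simp [letterEval]

theorem wordEval_toWord {d n : ℕ} (σ : PermTuple d n) (w : FS d) :
    wordEval σ w.toWord = act σ w := by
  rw [wordEval_eq_act, FreeGroup.mk_toWord]

theorem letterEval_eq_act {d n : ℕ} (σ : PermTuple d n) (l : Fin d × Bool) :
    letterEval σ l = act σ (FreeGroup.mk [l]) := by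
  rw [← wordEval_eq_act, wordEval]
  simp

theorem mem_stabIn {d n : ℕ} {σ : PermTuple d n} {P : Finset (FS d)} {x : Fin n} {w : FS d} :
    w ∈ stabIn σ P x ↔ w ∈ P ∧ act σ w x = x := by
  rw [stabIn, Finset.mem_filter, wordEval_toWord]

theorem stabIn_mem_powerset {d n : ℕ} (σ : PermTuple d n) (P : Finset (FS d)) (x : Fin n) :
    stabIn σ P x ∈ P.powerset :=
  Finset.mem_powerset.2 (Finset.filter_subset _ _)

/-- The tuple `σ` transported along the bijection `π` from labels to vertices. -/
def relabel {d n : ℕ} (π : Equiv.Perm (Fin n)) (σ : PermTuple d n) : PermTuple d n :=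
  fun j => π⁻¹ * σ j * π

theorem act_relabel {d n : ℕ} (π : Equiv.Perm (Fin n)) (σ : PermTuple d n) (w : FS d) :
    act (relabel π σ) w = π⁻¹ * act σ w * π := by
  have h : act (relabel π σ) = (MulAut.conj π⁻¹).toMonoidHom.comp (act σ) := by
    refine FreeGroup.ext_hom _ _ fun j => ?_
    simp [act, relabel]
  rw [h]
  simp

theorem letterEval_relabel {d n : ℕ} (π : Equiv.Perm (Fin n)) (σ : PermTuple d n)
    (l : Fin d × Bool) (x : Fin n) :
    letterEval (relabel π σ) l x = π⁻¹ (act σ (FreeGroup.mk [l]) (π x)) := by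
  rw [letterEval_eq_act, act_relabel]
  rfl

theorem relabel_mem_sol {d n : ℕ} {E : EqSystem d} (π : Equiv.Perm (Fin n)) {σ : PermTuple d n}
    (h : σ ∈ Sol E n) : relabel π σ ∈ Sol E n := by
  intro e he
  have := h e he
  rw [wordEval_eq_act, wordEval_eq_act] at this ⊢
  rw [act_relabel, act_relabel, this]

theorem relabel_inv_relabel {d n : ℕ} (π : Equiv.Perm (Fin n)) (σ : PermTuple d n) :
    relabel π (relabel π⁻¹ σ) = σ := by
  funext j
  simp only [relabel]
  group

theorem hamming_relabel {d n : ℕ} (π : Equiv.Perm (Fin n)) (σ τ : PermTuple d n) (j : Fin d) :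
    hamming (relabel π σ j) (relabel π τ j) = hamming (σ j) (τ j) := by
  unfold hamming
  congr 2
  refine Finset.card_bij (fun x _ => π x) ?_ ?_ ?_
  · intro x hx
    simpa [relabel] using hx
  · intro x _ y _ h
    exact π.injective h
  · intro y hy
    exact ⟨π⁻¹ y, by simpa [relabel] using hy, by simp⟩

theorem hamming_self {n : ℕ} (σ : Equiv.Perm (Fin n)) : hamming σ σ = 0 := by
  simp [hamming]

theorem relabel_mem_solFar {d n : ℕ} {E : EqSystem d} {ε : ℝ} (π : Equiv.Perm (Fin n))
    {σ : PermTuple d n} (h : σ ∈ SolFar E ε n) : relabel π σ ∈ SolFar E ε n := by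
  intro τ hτ
  have := h _ (relabel_mem_sol π⁻¹ hτ)
  rw [← relabel_inv_relabel π τ]
  simpa only [hamming_relabel] using this

/-! ### Probabilities of verdicts -/

theorem Tree.prob_add_prob {d n : ℕ} (σ : PermTuple d n) (T : Tree d n) :
    T.prob σ true + T.prob σ false = 1 := by
  induction T with
  | halt v => cases v <;> simp [Tree.prob]
  | sample m hm next ih =>
    simp only [Tree.prob]
    rw [← add_div, ← Finset.sum_add_distrib, Finset.sum_congr rfl fun i _ => ih i]
    simp [hm.ne']
  | query j pos x next ih => simpa [Tree.prob] using ih _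

theorem Tree.prob_nonneg {d n : ℕ} (σ : PermTuple d n) (b : Bool) (T : Tree d n) :
    0 ≤ T.prob σ b := by
  induction T with
  | halt v => simp only [Tree.prob]; split <;> norm_num
  | sample m hm next ih =>
    exact div_nonneg (Finset.sum_nonneg fun i _ => ih i) (Nat.cast_nonneg m)
  | query j pos x next ih => simpa [Tree.prob] using ih _

theorem Tree.prob_true_le_one {d n : ℕ} (σ : PermTuple d n) (T : Tree d n) :
    T.prob σ true ≤ 1 := by
  linarith [T.prob_add_prob σ, T.prob_nonneg σ false]

/-! ### Bijections extending a partial labelling -/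

/-- The bijections from labels to vertices that agree with `ρ` on the set `L` of labels. -/
def extensions {n : ℕ} (L : Finset (Fin n)) (ρ : Fin n → Fin n) : Finset (Equiv.Perm (Fin n)) :=
  Finset.univ.filter fun π => ∀ x ∈ L, π x = ρ x

theorem mem_extensions {n : ℕ} {L : Finset (Fin n)} {ρ : Fin n → Fin n} {π : Equiv.Perm (Fin n)} :
    π ∈ extensions L ρ ↔ ∀ x ∈ L, π x = ρ x := by
  simp [extensions]

theorem mem_extensions_insert {n : ℕ} {L : Finset (Fin n)} {ρ : Fin n → Fin n}
    {π : Equiv.Perm (Fin n)} {x a : Fin n} (hx : x ∉ L) :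
    π ∈ extensions (insert x L) (Function.update ρ x a) ↔ π ∈ extensions L ρ ∧ π x = a := by
  simp only [mem_extensions, Finset.forall_mem_insert, Function.update_self]
  rw [and_comm]
  refine and_congr_left fun _ => forall₂_congr fun y hy => ?_
  rw [Function.update_of_ne (ne_of_mem_of_not_mem hy hx)]

/-- Summation over the extensions according to the vertex that carries the label `x`. -/
theorem sum_extensions_label {n : ℕ} {L : Finset (Fin n)} {ρ : Fin n → Fin n} {x : Fin n}
    (hx : x ∉ L) (f : Equiv.Perm (Fin n) → ℝ) :
    ∑ π ∈ extensions L ρ, f π =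
      ∑ a ∈ (L.image ρ)ᶜ, ∑ π ∈ extensions (insert x L) (Function.update ρ x a), f π := by
  rw [← Finset.sum_fiberwise_of_maps_to (t := (L.image ρ)ᶜ) (g := fun π => π x)]
  · refine Finset.sum_congr rfl fun a _ => Finset.sum_congr ?_ fun _ _ => rfl
    ext π
    rw [Finset.mem_filter, mem_extensions_insert hx]
  · intro π hπ
    rw [Finset.mem_compl, Finset.mem_image]
    rintro ⟨y, hy, h⟩
    rw [← mem_extensions.1 hπ y hy] at h
    exact hx (π.injective h ▸ hy)

/-- Summation over the extensions according to the label of the vertex `b`. -/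
theorem sum_extensions_vertex {n : ℕ} {L : Finset (Fin n)} {ρ : Fin n → Fin n} {b : Fin n}
    (hb : b ∉ L.image ρ) (f : Equiv.Perm (Fin n) → ℝ) :
    ∑ π ∈ extensions L ρ, f π =
      ∑ y ∈ Lᶜ, ∑ π ∈ extensions (insert y L) (Function.update ρ y b), f π := by
  rw [← Finset.sum_fiberwise_of_maps_to (t := Lᶜ) (g := fun π => π⁻¹ b)]
  · refine Finset.sum_congr rfl fun y hy => Finset.sum_congr ?_ fun _ _ => rfl
    ext π
    rw [Finset.mem_filter, mem_extensions_insert (Finset.mem_compl.1 hy), Equiv.Perm.inv_eq_iff_eq,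
      eq_comm]
  · intro π hπ
    rw [Finset.mem_compl]
    intro hy
    refine hb (Finset.mem_image.2 ⟨_, hy, ?_⟩)
    rw [← mem_extensions.1 hπ _ hy]
    simp

theorem injOn_update {n : ℕ} {L : Finset (Fin n)} {ρ : Fin n → Fin n} {x a : Fin n}
    (hρ : Set.InjOn ρ L) (hx : x ∉ L) (ha : a ∉ L.image ρ) :
    Set.InjOn (Function.update ρ x a) (insert x L : Finset (Fin n)) := by
  have hL : ∀ y ∈ L, Function.update ρ x a y = ρ y := fun y hy =>
    Function.update_of_ne (ne_of_mem_of_not_mem hy hx) _ _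
  rw [Finset.coe_insert, Set.injOn_insert (by simpa using hx)]
  refine ⟨hρ.congr fun y hy => (hL y hy).symm, ?_⟩
  rintro ⟨y, hy, h⟩
  rw [hL y hy, Function.update_self] at h
  exact ha (Finset.mem_image.2 ⟨y, hy, h⟩)

theorem card_extensions {n : ℕ} {L : Finset (Fin n)} {ρ : Fin n → Fin n} (hρ : Set.InjOn ρ L) :
    (extensions L ρ).card = (n - L.card).factorial := by
  induction hk : n - L.card generalizing L ρ with
  | zero =>
    have hL : L = Finset.univ := by
      refine Finset.eq_univ_of_card _ (le_antisymm (Finset.card_le_univ _) ?_)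
      rw [Fintype.card_fin]
      omega
    subst hL
    have hinj : Function.Injective ρ := fun x y h => hρ (by simp) (by simp) h
    rw [Nat.factorial_zero, Finset.card_eq_one]
    refine ⟨Equiv.ofBijective ρ (Finite.injective_iff_bijective.1 hinj), ?_⟩
    ext π
    simp [mem_extensions, Equiv.ext_iff]
  | succ k ih =>
    obtain ⟨x, hx⟩ : ∃ x, x ∉ L := by
      by_contra! h
      rw [Finset.eq_univ_of_forall h, Finset.card_univ, Fintype.card_fin] at hk
      omega
    have h := sum_extensions_label (ρ := ρ) hx fun _ => 1
    have h' : ∀ a ∈ (L.image ρ)ᶜ,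
        ∑ π ∈ extensions (insert x L) (Function.update ρ x a), (1 : ℝ) = (k.factorial : ℝ) := by
      intro a ha
      rw [← ih (injOn_update hρ hx (Finset.mem_compl.1 ha))]
      · simp
      · rw [Finset.card_insert_of_notMem hx]
        omega
    rw [Finset.sum_congr rfl h'] at h
    simp only [Finset.sum_const, nsmul_eq_mul, mul_one, Finset.card_compl, Fintype.card_fin,
      Finset.card_image_of_injOn hρ, hk] at h
    rw [Nat.factorial_succ]
    exact_mod_cast h

/-! ### Comparing sums through types -/

/-- If `u a ≤ v b + e` whenever `a ∈ G` and `b ∈ G'` have the same type, then the sums of `u` and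
`v` differ by little, provided that few points are outside `G` and `G'` and that each type is about
as frequent among the `a` as among the `b`. -/
theorem sum_le_sum_of_types {ι κ : Type*} [Fintype ι] [DecidableEq ι] [DecidableEq κ]
    {A B G G' : Finset ι} (hG : G ⊆ A) (hG' : G' ⊆ B) (Ω : Finset κ) (s t : ι → κ)
    (hs : ∀ a, s a ∈ Ω) (ht : ∀ b, t b ∈ Ω) (u v : ι → ℝ) {M e : ℝ} (he : 0 ≤ e)
    (hu : ∀ a ∈ A, u a ≤ M) (hv : ∀ b ∈ B, 0 ≤ v b ∧ v b ≤ M) (hM : 0 ≤ M)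
    (h : ∀ a ∈ G, ∀ b ∈ G', s a = t b → u a ≤ v b + e) :
    ∑ a ∈ A, u a ≤ ∑ b ∈ B, v b + A.card * e + M * ((Gᶜ.card : ℝ) + G'ᶜ.card +
      ∑ Y ∈ Ω, |((Finset.univ.filter fun a => s a = Y).card : ℝ) -
        (Finset.univ.filter fun b => t b = Y).card|) := by
  have key : ∀ Y ∈ Ω, ∑ a ∈ G.filter (fun a => s a = Y), u a ≤
      ∑ b ∈ G'.filter (fun b => t b = Y), v b + (G.filter (fun a => s a = Y)).card * e +
      M * ((G'ᶜ.filter (fun b => t b = Y)).card +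
        |((Finset.univ.filter fun a => s a = Y).card : ℝ) -
          (Finset.univ.filter fun b => t b = Y).card|) := by
    intro Y _
    have h1 : ((G.filter (fun a => s a = Y)).card : ℝ) ≤
        (Finset.univ.filter fun a => s a = Y).card := by
      exact_mod_cast Finset.card_le_card (Finset.filter_subset_filter _ (Finset.subset_univ _))
    have h2 : ((Finset.univ.filter fun b => t b = Y).card : ℝ) =
        (G'.filter (fun b => t b = Y)).card + (G'ᶜ.filter (fun b => t b = Y)).card := by
      rw [← Nat.cast_add, ← Finset.card_union_of_disjoint, ← Finset.filter_union,
        Finset.union_compl]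
      exact Finset.disjoint_filter_filter disjoint_compl_right
    have h3 := le_abs_self (((Finset.univ.filter fun a => s a = Y).card : ℝ) -
          (Finset.univ.filter fun b => t b = Y).card)
    set D := |((Finset.univ.filter fun a => s a = Y).card : ℝ) -
          (Finset.univ.filter fun b => t b = Y).card| with hD
    have hD0 : 0 ≤ D := abs_nonneg _
    rcases (G'.filter (fun b => t b = Y)).eq_empty_or_nonempty with h0 | hne
    · have h4 : ∑ a ∈ G.filter (fun a => s a = Y), u a ≤ (G.filter (fun a => s a = Y)).card * M := by
        rw [← nsmul_eq_mul]
        exact Finset.sum_le_card_nsmul _ _ _ fun a ha => hu a (hG (Finset.mem_filter.1 ha).1)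
      rw [h0] at h2 ⊢
      simp only [Finset.card_empty, Nat.cast_zero, zero_add, Finset.sum_empty] at h2 ⊢
      have h5 : (0 : ℝ) ≤ (G.filter (fun a => s a = Y)).card * e := by positivity
      nlinarith
    · obtain ⟨b, hb, hmin⟩ := Finset.exists_min_image _ v hne
      have hb' := Finset.mem_filter.1 hb
      obtain ⟨hv0, hvM⟩ := hv b (hG' hb'.1)
      have h4 : ∑ a ∈ G.filter (fun a => s a = Y), u a ≤
          (G.filter (fun a => s a = Y)).card * (v b + e) := by
        rw [← nsmul_eq_mul]
        refine Finset.sum_le_card_nsmul _ _ _ fun a ha => ?_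
        obtain ⟨ha1, ha2⟩ := Finset.mem_filter.1 ha
        exact h a ha1 b hb'.1 (ha2.trans hb'.2.symm)
      have h5 : (G'.filter (fun b => t b = Y)).card * v b ≤
          ∑ b ∈ G'.filter (fun b => t b = Y), v b := by
        rw [← nsmul_eq_mul]
        exact Finset.card_nsmul_le_sum _ _ _ hmin
      have h6 : 0 ≤ (G'ᶜ.filter (fun b => t b = Y)).card + D := by positivity
      have h7 : ((G.filter (fun a => s a = Y)).card : ℝ) - (G'.filter (fun b => t b = Y)).card ≤
          (G'ᶜ.filter (fun b => t b = Y)).card + D := by linarith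
      nlinarith [mul_le_mul_of_nonneg_right h7 hv0, mul_le_mul_of_nonneg_left hvM h6]
  have hsum := Finset.sum_le_sum key
  rw [Finset.sum_fiberwise_of_maps_to (fun a _ => hs a)] at hsum
  simp only [Finset.sum_add_distrib, ← Finset.mul_sum, ← Finset.sum_mul] at hsum
  rw [Finset.sum_fiberwise_of_maps_to (fun a _ => ht a), ← Nat.cast_sum, ← Nat.cast_sum,
    ← Finset.card_eq_sum_card_fiberwise (fun a _ => hs a),
    ← Finset.card_eq_sum_card_fiberwise (fun a _ => ht a)] at hsum
  have hA : ∑ a ∈ A, u a ≤ ∑ a ∈ G, u a + Gᶜ.card * M := by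
    rw [← Finset.sum_sdiff hG, add_comm]
    gcongr
    calc ∑ a ∈ A \ G, u a ≤ (A \ G).card * M := by
          rw [← nsmul_eq_mul]
          exact Finset.sum_le_card_nsmul _ _ _ fun a ha => hu a (Finset.mem_sdiff.1 ha).1
      _ ≤ Gᶜ.card * M := by
          gcongr
          intro a ha
          exact Finset.mem_compl.2 (Finset.mem_sdiff.1 ha).2
  have hB : ∑ b ∈ G', v b ≤ ∑ b ∈ B, v b :=
    Finset.sum_le_sum_of_subset_of_nonneg hG' fun b hb _ => (hv b hb).1
  have hc : (G.card : ℝ) * e ≤ A.card * e := by gcongr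
  linarith

/-! ### Exploring two randomly labelled tuples in parallel -/

/-- A finite set of group elements that contains all those of length at most `R`. -/
noncomputable def ball (d R : ℕ) : Finset (FS d) :=
  (List.finite_length_le (Fin d × Bool) R).toFinset.image FreeGroup.mk

theorem mem_ball {d R : ℕ} {w : FS d} (hw : w.norm ≤ R) : w ∈ ball d R :=
  Finset.mem_image.2 ⟨w.toWord, by simpa [FreeGroup.norm] using hw, FreeGroup.mk_toWord⟩

/-- The matching `ρ x ↦ ρ' x` (`x ∈ L`) of vertices of `σ` with vertices of `τ` respects the
relations `w a = a'` for all words `w` of length at most `R`. -/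
def LocalEquiv {d n : ℕ} (σ τ : PermTuple d n) (R : ℕ) (L : Finset (Fin n))
    (ρ ρ' : Fin n → Fin n) : Prop :=
  ∀ x ∈ L, ∀ y ∈ L, ∀ w : FS d, w.norm ≤ R → (act σ w (ρ x) = ρ y ↔ act τ w (ρ' x) = ρ' y)

theorem LocalEquiv.mono {d n : ℕ} {σ τ : PermTuple d n} {R R' : ℕ} {L : Finset (Fin n)}
    {ρ ρ' : Fin n → Fin n} (h : LocalEquiv σ τ R L ρ ρ') (hR : R' ≤ R) :
    LocalEquiv σ τ R' L ρ ρ' :=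
  fun x hx y hy w hw => h x hx y hy w (hw.trans hR)

theorem LocalEquiv.injOn {d n : ℕ} {σ τ : PermTuple d n} {R : ℕ} {L : Finset (Fin n)}
    {ρ ρ' : Fin n → Fin n} (h : LocalEquiv σ τ R L ρ ρ') (hρ : Set.InjOn ρ L) :
    Set.InjOn ρ' L := fun x hx y hy hxy =>
  hρ hx hy <| by simpa using (h x hx y hy 1 (by simp)).2 (by simpa using hxy)

theorem LocalEquiv.insert {d n : ℕ} {σ τ : PermTuple d n} {R : ℕ} {L : Finset (Fin n)}
    {ρ ρ' : Fin n → Fin n} (h : LocalEquiv σ τ R L ρ ρ') {y b b' : Fin n} (hy : y ∉ L)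
    (hself : ∀ w : FS d, w.norm ≤ R → (act σ w b = b ↔ act τ w b' = b'))
    (hlink : ∀ x ∈ L, ∀ w : FS d, w.norm ≤ R → (act σ w b = ρ x ↔ act τ w b' = ρ' x)) :
    LocalEquiv σ τ R (insert y L) (Function.update ρ y b) (Function.update ρ' y b') := by
  have hL : ∀ (f : Fin n → Fin n) (c : Fin n), ∀ x ∈ L, Function.update f y c x = f x :=
    fun f c x hx => Function.update_of_ne (ne_of_mem_of_not_mem hx hy) _ _
  intro x hx z hz w hw
  rcases Finset.mem_insert.1 hx with rfl | hx' <;> rcases Finset.mem_insert.1 hz with rfl | hz'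
  · simpa using hself w hw
  · simpa [hL _ _ z hz'] using hlink z hz' w hw
  · have := hlink x hx' w⁻¹ (by rwa [FreeGroup.norm_inv_eq])
    rw [map_inv, map_inv, Equiv.Perm.inv_eq_iff_eq, Equiv.Perm.inv_eq_iff_eq, eq_comm,
      eq_comm (a := b')] at this
    simpa [hL _ _ x hx'] using this
  · simpa [hL _ _ x hx', hL _ _ z hz'] using h x hx' z hz' w hw

/-- Moving along one edge keeps the matching a local equivalence, with a radius smaller by two. -/
theorem LocalEquiv.insert_neighbour {d n : ℕ} {σ τ : PermTuple d n} {R : ℕ} {L : Finset (Fin n)}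
    {ρ ρ' : Fin n → Fin n} (h : LocalEquiv σ τ (R + 2) L ρ ρ') {x y : Fin n} (hx : x ∈ L)
    (hy : y ∉ L) {s : FS d} (hs : s.norm ≤ 1) :
    LocalEquiv σ τ R (Insert.insert y L) (Function.update ρ y (act σ s (ρ x)))
      (Function.update ρ' y (act τ s (ρ' x))) := by
  refine (h.mono (Nat.le_add_right R 2)).insert hy ?_ ?_
  · intro w hw
    have h1 : (s⁻¹ * (w * s)).norm ≤ R + 2 := by
      have := FreeGroup.norm_mul_le s⁻¹ (w * s)
      have := FreeGroup.norm_mul_le w s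
      rw [FreeGroup.norm_inv_eq] at *
      omega
    have := h x hx x hx _ h1
    simpa only [map_mul, map_inv, Equiv.Perm.mul_apply, Equiv.Perm.inv_eq_iff_eq] using this
  · intro z hz w hw
    have h1 : (w * s).norm ≤ R + 2 := by
      have := FreeGroup.norm_mul_le w s
      omega
    simpa only [map_mul, Equiv.Perm.mul_apply] using h x hx z hz _ h1

/-- The vertices joined to one of the vertices `ρ x`, `x ∈ L`, by an element of `ball d R`. -/
noncomputable def linked {d n : ℕ} (σ : PermTuple d n) (R : ℕ) (L : Finset (Fin n))
    (ρ : Fin n → Fin n) : Finset (Fin n) :=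
  L.biUnion fun x => (ball d R).image fun w => act σ w (ρ x)

theorem card_linked_le {d n : ℕ} (σ : PermTuple d n) (R : ℕ) (L : Finset (Fin n))
    (ρ : Fin n → Fin n) : (linked σ R L ρ).card ≤ L.card * (ball d R).card :=
  Finset.card_biUnion_le_card_mul _ _ _ fun _ _ => Finset.card_image_le

theorem act_ne_of_notMem_linked {d n : ℕ} {σ : PermTuple d n} {R : ℕ} {L : Finset (Fin n)}
    {ρ : Fin n → Fin n} {a x : Fin n} (ha : a ∉ linked σ R L ρ) (hx : x ∈ L) {w : FS d}
    (hw : w.norm ≤ R) : act σ w a ≠ ρ x := by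
  intro h
  refine ha (Finset.mem_biUnion.2 ⟨x, hx, Finset.mem_image.2 ⟨w⁻¹, mem_ball ?_, ?_⟩⟩)
  · rwa [FreeGroup.norm_inv_eq]
  · rw [← h, map_inv]
    simp

/-- The number of labellings that extend `ρ`, each weighted with the probability that `T` accepts
the relabelled tuple. -/
noncomputable def acceptWeight {d n : ℕ} (σ : PermTuple d n) (T : Tree d n) (L : Finset (Fin n))
    (ρ : Fin n → Fin n) : ℝ :=
  ∑ π ∈ extensions L ρ, T.prob (relabel π σ) true

theorem acceptWeight_nonneg {d n : ℕ} (σ : PermTuple d n) (T : Tree d n) (L : Finset (Fin n))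
    (ρ : Fin n → Fin n) : 0 ≤ acceptWeight σ T L ρ :=
  Finset.sum_nonneg fun _ _ => T.prob_nonneg _ _

theorem acceptWeight_le {d n : ℕ} (σ : PermTuple d n) (T : Tree d n) {L : Finset (Fin n)}
    {ρ : Fin n → Fin n} (hρ : Set.InjOn ρ L) :
    acceptWeight σ T L ρ ≤ ((n - L.card).factorial : ℝ) := by
  rw [← card_extensions hρ, ← nsmul_one]
  exact Finset.sum_le_card_nsmul _ _ _ fun _ _ => T.prob_true_le_one _

theorem acceptWeight_query_of_known {d n : ℕ} (σ : PermTuple d n) {j : Fin d} {pos : Bool}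
    {x y : Fin n} {next : Fin n → Tree d n} {L : Finset (Fin n)} {ρ : Fin n → Fin n} (hx : x ∈ L)
    (hy : y ∈ L) (h : act σ (FreeGroup.mk [(j, pos)]) (ρ x) = ρ y) :
    acceptWeight σ (.query j pos x next) L ρ = acceptWeight σ (next y) L ρ := by
  refine Finset.sum_congr rfl fun π hπ => ?_
  rw [Tree.prob, letterEval_relabel, mem_extensions.1 hπ x hx, h, ← mem_extensions.1 hπ y hy]
  simp

theorem acceptWeight_query_of_new {d n : ℕ} (σ : PermTuple d n) {j : Fin d} {pos : Bool}
    {x : Fin n} {next : Fin n → Tree d n} {L : Finset (Fin n)} {ρ : Fin n → Fin n} (hx : x ∈ L)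
    (h : act σ (FreeGroup.mk [(j, pos)]) (ρ x) ∉ L.image ρ) :
    acceptWeight σ (.query j pos x next) L ρ =
      ∑ y ∈ Lᶜ, acceptWeight σ (next y) (insert y L)
        (Function.update ρ y (act σ (FreeGroup.mk [(j, pos)]) (ρ x))) := by
  rw [acceptWeight, sum_extensions_vertex h]
  refine Finset.sum_congr rfl fun y hy => Finset.sum_congr rfl fun π hπ => ?_
  obtain ⟨h1, h2⟩ := (mem_extensions_insert (Finset.mem_compl.1 hy)).1 hπ
  rw [Tree.prob, letterEval_relabel, mem_extensions.1 h1 x hx, ← h2]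
  simp

theorem sum_factorial_insert {n : ℕ} (L : Finset (Fin n)) :
    ∑ y ∈ Lᶜ, ((n - (insert y L).card).factorial : ℝ) ≤ ((n - L.card).factorial : ℝ) := by
  have h : ∀ y ∈ Lᶜ, ((n - (insert y L).card).factorial : ℝ) = (n - L.card - 1).factorial := by
    intro y hy
    rw [Finset.card_insert_of_notMem (Finset.mem_compl.1 hy), Nat.sub_add_eq]
  rw [Finset.sum_congr rfl h, Finset.sum_const, Finset.card_compl, Fintype.card_fin, nsmul_eq_mul]
  rcases Nat.eq_zero_or_pos (n - L.card) with h0 | h0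
  · rw [h0]; simp
  · rw [← Nat.mul_factorial_pred h0.ne']; push_cast; rfl

/-- A query at a revealed label: the answer is either a revealed label, the same on both sides, or
a uniformly random unrevealed one on both sides. -/
theorem acceptWeight_query_le {d n : ℕ} {σ τ : PermTuple d n} {j : Fin d} {pos : Bool} {x : Fin n}
    {next : Fin n → Tree d n} {k : ℕ} {c : ℝ} {L : Finset (Fin n)} {ρ ρ' : Fin n → Fin n}
    (ih : ∀ (y : Fin n) (L' : Finset (Fin n)) (r r' : Fin n → Fin n), L'.card ≤ L.card + 1 →
      Set.InjOn r L' → LocalEquiv σ τ (2 * k) L' r r' →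
      (∀ π ∈ extensions L' r, (next y).queryCount (relabel π σ) ≤ k) →
      acceptWeight σ (next y) L' r ≤
        acceptWeight τ (next y) L' r' + c * ((n - L'.card).factorial : ℝ)) (hc : 0 ≤ c)
    (hx : x ∈ L) (hρ : Set.InjOn ρ L) (hloc : LocalEquiv σ τ (2 * k + 2) L ρ ρ')
    (hq : ∀ π ∈ extensions L ρ,
      (Tree.query j pos x next).queryCount (relabel π σ) ≤ k + 1) :
    acceptWeight σ (.query j pos x next) L ρ ≤
      acceptWeight τ (.query j pos x next) L ρ' + c * ((n - L.card).factorial : ℝ) := by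
  have hs : (FreeGroup.mk [(j, pos)] : FS d).norm ≤ 1 := FreeGroup.norm_mk_le
  have hiff : ∀ y ∈ L, (act σ (FreeGroup.mk [(j, pos)]) (ρ x) = ρ y ↔
      act τ (FreeGroup.mk [(j, pos)]) (ρ' x) = ρ' y) := fun y hy =>
    hloc x hx y hy _ (by omega)
  have hq' : ∀ π ∈ extensions L ρ,
      (next (π⁻¹ (act σ (FreeGroup.mk [(j, pos)]) (ρ x)))).queryCount (relabel π σ) ≤ k := by
    intro π hπ
    have := hq π hπ
    rw [Tree.queryCount, letterEval_relabel, mem_extensions.1 hπ x hx] at this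
    omega
  by_cases hmem : ∃ y ∈ L, act σ (FreeGroup.mk [(j, pos)]) (ρ x) = ρ y
  · obtain ⟨y, hy, h⟩ := hmem
    rw [acceptWeight_query_of_known σ hx hy h,
      acceptWeight_query_of_known τ hx hy ((hiff y hy).1 h)]
    refine ih y L ρ ρ' (Nat.le_succ _) hρ (hloc.mono (by omega)) fun π hπ => ?_
    have := hq' π hπ
    rw [h, ← mem_extensions.1 hπ y hy] at this
    simpa using this
  · have h1 : act σ (FreeGroup.mk [(j, pos)]) (ρ x) ∉ L.image ρ := by
      rw [Finset.mem_image]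
      rintro ⟨y, hy, h⟩
      exact hmem ⟨y, hy, h.symm⟩
    have h2 : act τ (FreeGroup.mk [(j, pos)]) (ρ' x) ∉ L.image ρ' := by
      rw [Finset.mem_image]
      rintro ⟨y, hy, h⟩
      exact hmem ⟨y, hy, (hiff y hy).2 h.symm⟩
    rw [acceptWeight_query_of_new σ hx h1, acceptWeight_query_of_new τ hx h2]
    refine le_trans (Finset.sum_le_sum (g := fun y => acceptWeight τ (next y) (insert y L)
      (Function.update ρ' y (act τ (FreeGroup.mk [(j, pos)]) (ρ' x))) +
        c * ((n - (insert y L).card).factorial : ℝ)) fun y hy => ?_) ?_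
    · have hy := Finset.mem_compl.1 hy
      refine ih y _ _ _ (Finset.card_insert_le _ _) (injOn_update hρ hy h1)
        (hloc.insert_neighbour hx hy hs) fun π hπ => ?_
      obtain ⟨h3, h4⟩ := (mem_extensions_insert hy).1 hπ
      have := hq' π h3
      rw [← h4] at this
      simpa using this
    · rw [Finset.sum_add_distrib, ← Finset.mul_sum, add_le_add_iff_left]
      exact mul_le_mul_of_nonneg_left (sum_factorial_insert L) hc

/-- The number of points, summed over the types, by which the statistics of `σ` and `τ` differ. -/
noncomputable def statDiff {d n : ℕ} (σ τ : PermTuple d n) (P : Finset (FS d)) : ℝ :=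
  ∑ Y ∈ P.powerset, |((Finset.univ.filter fun a => stabIn σ P a = Y).card : ℝ) -
    (Finset.univ.filter fun b => stabIn τ P b = Y).card|

theorem statDiff_eq {d n : ℕ} (hn : 0 < n) (σ τ : PermTuple d n) (P : Finset (FS d)) :
    statDiff σ τ P = 2 * n * dTV P.powerset (localStat σ P) (localStat τ P) := by
  have hn' : (0 : ℝ) < n := Nat.cast_pos.2 hn
  unfold statDiff dTV localStat uniformLaw
  rw [Fintype.card_fin, show ∀ s : ℝ, 2 * (n : ℝ) * (1 / 2 * s) = n * s from fun s => by ring,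
    Finset.mul_sum]
  refine Finset.sum_congr rfl fun Y _ => ?_
  rw [← sub_div, abs_div, abs_of_pos hn']
  field_simp

/-- A tree cannot tell two randomly labelled tuples with similar statistics apart: each query
contributes at most `β` to the difference of the acceptance probabilities. -/
theorem acceptWeight_le_add {d n q : ℕ} {σ τ : PermTuple d n} {P : Finset (FS d)} {β : ℝ}
    (hP : ball d (2 * q) ⊆ P) (hqn : 2 * q ≤ n) (hβ : 0 ≤ β)
    (hstat : statDiff σ τ P + 2 * (2 * q * (ball d (2 * q)).card) ≤ β * (n - 2 * q))
    (T : Tree d n) (k : ℕ) (L : Finset (Fin n)) (ρ ρ' : Fin n → Fin n)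
    (hL : L.card + 2 * k ≤ 2 * q) (hρ : Set.InjOn ρ L) (hloc : LocalEquiv σ τ (2 * k) L ρ ρ')
    (hcount : ∀ π ∈ extensions L ρ, T.queryCount (relabel π σ) ≤ k) :
    acceptWeight σ T L ρ ≤ acceptWeight τ T L ρ' + k * β * ((n - L.card).factorial : ℝ) := by
  induction T generalizing k L ρ ρ' with
  | halt v =>
    have h : acceptWeight σ (.halt v) L ρ = acceptWeight τ (.halt v) L ρ' := by
      simp [acceptWeight, Tree.prob, card_extensions hρ, card_extensions (hloc.injOn hρ)]
    rw [h, le_add_iff_nonneg_right]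
    positivity
  | sample m hm next ih =>
    have hm' : (0 : ℝ) < m := Nat.cast_pos.2 hm
    have h : ∀ (σ : PermTuple d n) (r : Fin n → Fin n), acceptWeight σ (.sample m hm next) L r =
        (∑ i, acceptWeight σ (next i) L r) / m := by
      intro σ r
      simp only [acceptWeight, Tree.prob]
      rw [← Finset.sum_div, Finset.sum_comm]
    rw [h, h, div_le_iff₀ hm', add_mul, div_mul_cancel₀ _ hm'.ne']
    refine (Finset.sum_le_sum fun i _ => ih i k L ρ ρ' hL hρ hloc fun π hπ => ?_).trans ?_
    · refine le_trans ?_ (hcount π hπ)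
      exact Finset.le_sup (f := fun i => (next i).queryCount (relabel π σ)) (Finset.mem_univ i)
    · rw [Finset.sum_add_distrib]
      simp only [Finset.sum_const, Finset.card_univ, Fintype.card_fin, nsmul_eq_mul]
      linarith
  | query j pos x next ih =>
    obtain ⟨k, rfl⟩ : ∃ k', k = k' + 1 := by
      have hne : (extensions L ρ).Nonempty := by
        rw [← Finset.card_pos, card_extensions hρ]
        exact Nat.factorial_pos _
      obtain ⟨π, hπ⟩ := hne
      have := hcount π hπ
      rw [Tree.queryCount] at this
      exact ⟨k - 1, by omega⟩
    have hstep : ∀ (L : Finset (Fin n)) (ρ ρ' : Fin n → Fin n), L.card + 2 * k + 1 ≤ 2 * q →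
        x ∈ L → Set.InjOn ρ L → LocalEquiv σ τ (2 * k + 2) L ρ ρ' →
        (∀ π ∈ extensions L ρ,
          (Tree.query j pos x next).queryCount (relabel π σ) ≤ k + 1) →
        acceptWeight σ (.query j pos x next) L ρ ≤ acceptWeight τ (.query j pos x next) L ρ' +
          k * β * ((n - L.card).factorial : ℝ) := by
      intro L ρ ρ' hL hx hρ hloc hcount
      refine acceptWeight_query_le (fun y L' r r' hL' hr hloc' hcount' => ?_) (by positivity) hx hρ
        hloc hcount
      exact ih y k L' r r' (by omega) hr hloc' hcount'
    by_cases hx : x ∈ L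
    · refine (hstep L ρ ρ' (by omega) hx hρ hloc hcount).trans ?_
      gcongr
      linarith
    -- The label `x` is new: its vertex is uniform on both sides, and a pair of unlinked vertices
    -- of the same type extends the local equivalence.
    have hρ' := hloc.injOn hρ
    set M : ℝ := ((n - L.card - 1).factorial : ℝ) with hM
    have hsplit : ∀ (σ : PermTuple d n) (r : Fin n → Fin n),
        acceptWeight σ (.query j pos x next) L r = ∑ a ∈ (L.image r)ᶜ,
          acceptWeight σ (.query j pos x next) (insert x L) (Function.update r x a) :=
      fun σ r => sum_extensions_label hx _
    have hle : ∀ (σ : PermTuple d n) (r : Fin n → Fin n), Set.InjOn r L → ∀ a ∈ (L.image r)ᶜ,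
        acceptWeight σ (.query j pos x next) (insert x L) (Function.update r x a) ≤ M := by
      intro σ r hr a ha
      have := acceptWeight_le σ (.query j pos x next) (injOn_update hr hx (Finset.mem_compl.1 ha))
      rwa [Finset.card_insert_of_notMem hx, Nat.sub_add_eq] at this
    have hsub : ∀ (σ : PermTuple d n) (r : Fin n → Fin n),
        (linked σ (2 * q) L r)ᶜ ⊆ (L.image r)ᶜ := by
      intro σ r a ha
      rw [Finset.mem_compl] at ha ⊢
      intro h
      obtain ⟨y, hy, h⟩ := Finset.mem_image.1 h
      exact act_ne_of_notMem_linked ha hy (w := 1) (by simp) (by simp [h])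
    have hmain := sum_le_sum_of_types (hsub σ ρ) (hsub τ ρ') P.powerset (stabIn σ P) (stabIn τ P)
      (stabIn_mem_powerset σ P) (stabIn_mem_powerset τ P)
      (fun a => acceptWeight σ (.query j pos x next) (insert x L) (Function.update ρ x a))
      (fun b => acceptWeight τ (.query j pos x next) (insert x L) (Function.update ρ' x b))
      (M := M) (e := k * β * M) (by positivity) (hle σ ρ hρ)
      (fun b hb => ⟨acceptWeight_nonneg _ _ _ _, hle τ ρ' hρ' b hb⟩) (by positivity) ?_
    · rw [← hsplit, ← hsplit, compl_compl, compl_compl, ← statDiff, Finset.card_compl,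
        Fintype.card_fin, Finset.card_image_of_injOn hρ] at hmain
      refine hmain.trans ?_
      have hLn : 0 < n - L.card := by omega
      have hfac : ((n - L.card).factorial : ℝ) = (n - L.card : ℕ) * M := by
        rw [hM, ← Nat.mul_factorial_pred hLn.ne']
        push_cast
        rfl
      have hlink : ∀ (σ : PermTuple d n) (r : Fin n → Fin n),
          ((linked σ (2 * q) L r).card : ℝ) ≤ 2 * q * (ball d (2 * q)).card := by
        intro σ r
        have := (card_linked_le σ (2 * q) L r).trans
          (Nat.mul_le_mul_right _ (show L.card ≤ 2 * q by omega))
        exact_mod_cast this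
      have hcard : (n : ℝ) - 2 * q ≤ (n - L.card : ℕ) := by
        rw [Nat.cast_sub (by omega)]
        have : (L.card : ℝ) ≤ 2 * q := by exact_mod_cast (show L.card ≤ 2 * q by omega)
        linarith
      have hbad : ((linked σ (2 * q) L ρ).card : ℝ) + (linked τ (2 * q) L ρ').card +
          statDiff σ τ P ≤ β * (n - L.card : ℕ) := by
        have := mul_le_mul_of_nonneg_left hcard hβ
        linarith [hlink σ ρ, hlink τ ρ']
      rw [hfac, Nat.cast_succ]
      have := mul_le_mul_of_nonneg_left hbad (show (0 : ℝ) ≤ M by positivity)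
      nlinarith
    · intro a ha b hb hab
      rw [Finset.mem_compl] at ha hb
      have hxcard := Finset.card_insert_of_notMem hx
      have := hstep (insert x L) (Function.update ρ x a) (Function.update ρ' x b)
        (by omega) (Finset.mem_insert_self x L)
        (injOn_update hρ hx (Finset.mem_compl.1 (hsub σ ρ (Finset.mem_compl.2 ha)))) ?_ ?_
      · rwa [hxcard, Nat.sub_add_eq] at this
      · refine hloc.insert hx (fun w hw => ?_) fun y hy w hw => ?_
        · have hwP : w ∈ P := hP (mem_ball (hw.trans (by omega)))
          have := Finset.ext_iff.1 hab w
          simpa only [mem_stabIn, hwP, true_and] using this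
        · exact iff_of_false (act_ne_of_notMem_linked ha hy (hw.trans (by omega)))
            (act_ne_of_notMem_linked hb hy (hw.trans (by omega)))
      · intro π hπ
        exact hcount π ((mem_extensions_insert hx).1 hπ).1

/-- On large inputs, a tree that accepts all conjugates of `σ` and rejects all conjugates of `τ`
with high probability forces the local statistics of `σ` and `τ` to be far apart. -/
theorem exists_le_dTV_of_large (d q : ℕ) : ∃ (n₀ : ℕ) (δ : ℝ), 0 < δ ∧
    ∀ (P : Finset (FS d)), ball d (2 * q) ⊆ P → ∀ n : ℕ, n₀ ≤ n → 0 < n →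
    ∀ (T : Tree d n), (∀ σ, T.queryCount σ ≤ q) → ∀ σ τ : PermTuple d n,
    (∀ π, 0.99 ≤ T.prob (relabel π σ) true) → (∀ π, 0.99 ≤ T.prob (relabel π τ) false) →
    δ ≤ dTV P.powerset (localStat σ P) (localStat τ P) := by
  set B : ℝ := 2 * (2 * q * (ball d (2 * q)).card) with hB
  have hB0 : 0 ≤ B := by positivity
  set β : ℝ := 1 / (2 * (q + 1)) with hβ
  have hβ0 : 0 < β := by positivity
  obtain ⟨n₀, hn₀⟩ := exists_nat_ge ((B + β * (2 * q)) * 2 / β)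
  refine ⟨max n₀ (2 * q), β / 4, by positivity, ?_⟩
  intro P hP n hn hn0 T hT σ τ hσ hτ
  by_contra! hlt
  have hn' : (0 : ℝ) < n := Nat.cast_pos.2 hn0
  have hnn₀ : (n₀ : ℝ) ≤ n := by exact_mod_cast (le_max_left _ _).trans hn
  have hstat : statDiff σ τ P + B ≤ β * (n - 2 * q) := by
    rw [statDiff_eq hn0]
    have h1 : (B + β * (2 * q)) * 2 ≤ n * β := (div_le_iff₀ hβ0).1 (hn₀.trans hnn₀)
    have h2 : 2 * n * dTV P.powerset (localStat σ P) (localStat τ P) ≤ 2 * n * (β / 4) := by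
      gcongr
    linarith
  have hmain := acceptWeight_le_add hP ((le_max_right _ _).trans hn) hβ0.le hstat T q ∅ id id
    (by simp) (by simp) (fun x hx => by simp at hx) fun π _ => hT _
  have hcard : ((extensions (∅ : Finset (Fin n)) id).card : ℝ) = n.factorial := by
    rw [card_extensions (by simp)]
    simp
  have h1 : (n.factorial : ℝ) * 0.99 ≤ acceptWeight σ T ∅ id := by
    rw [← hcard, ← nsmul_eq_mul]
    exact Finset.card_nsmul_le_sum _ _ _ fun π _ => hσ π
  have h2 : acceptWeight τ T ∅ id ≤ (n.factorial : ℝ) * 0.01 := by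
    rw [← hcard, ← nsmul_eq_mul]
    refine Finset.sum_le_card_nsmul _ _ _ fun π _ => ?_
    linarith [hτ π, T.prob_add_prob (relabel π τ)]
  have hf : (0 : ℝ) < n.factorial := by exact_mod_cast n.factorial_pos
  have hqβ : q * β ≤ 1 / 2 := by
    rw [hβ, mul_one_div, div_le_iff₀ (by positivity)]
    linarith
  rw [Finset.card_empty, Nat.sub_zero] at hmain
  nlinarith

/-! ### Finite actions with the same stabilizer statistics are conjugate -/

/-- A set of vertices of `σ` and an equivariant injection of it into the vertices of `τ`. -/
structure PartialIso {d n : ℕ} (σ τ : PermTuple d n) (A : Finset (Fin n)) (f : Fin n → Fin n) :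
    Prop where
  mapsTo : ∀ x ∈ A, ∀ w, act σ w x ∈ A
  injOn : Set.InjOn f A
  equivariant : ∀ x ∈ A, ∀ w, f (act σ w x) = act τ w (f x)

theorem PartialIso.stab_iff {d n : ℕ} {σ τ : PermTuple d n} {A : Finset (Fin n)}
    {f : Fin n → Fin n} (h : PartialIso σ τ A f) {x : Fin n} (hx : x ∈ A) (w : FS d) :
    act σ w x = x ↔ act τ w (f x) = f x := by
  rw [← h.equivariant x hx, h.injOn.eq_iff (h.mapsTo x hx w) hx]

theorem PartialIso.stabIn_eq {d n : ℕ} {σ τ : PermTuple d n} {A : Finset (Fin n)}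
    {f : Fin n → Fin n} (h : PartialIso σ τ A f) {x : Fin n} (hx : x ∈ A) (P : Finset (FS d)) :
    stabIn τ P (f x) = stabIn σ P x := by
  ext w
  rw [mem_stabIn, mem_stabIn, h.stab_iff hx]

/-- An equivariant injection extends to the orbit of `x` if some new vertex of `τ` has the same
stabilizer as `x`. -/
theorem PartialIso.extend {d n : ℕ} {σ τ : PermTuple d n} {A : Finset (Fin n)}
    {f : Fin n → Fin n} (h : PartialIso σ τ A f) {x y : Fin n} (hx : x ∉ A) (hy : y ∉ A.image f)
    (hxy : ∀ w, act σ w x = x ↔ act τ w y = y) :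
    ∃ A' f', PartialIso σ τ A' f' ∧ A ⊂ A' := by
  classical
  set O : Finset (Fin n) := Finset.univ.filter fun z => ∃ w, act σ w x = z with hO
  have memO : ∀ {z}, z ∈ O ↔ ∃ w, act σ w x = z := by simp [hO]
  have hxO : ∀ w, act σ w x ∈ O := fun w => memO.2 ⟨w, rfl⟩
  have hdisj : ∀ z ∈ O, z ∉ A := by
    intro z hz hzA
    obtain ⟨w, rfl⟩ := memO.1 hz
    have := h.mapsTo _ hzA w⁻¹
    rw [map_inv] at this
    exact hx (by simpa using this)
  have hrel : ∀ w w', act σ w x = act σ w' x ↔ act τ w y = act τ w' y := by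
    intro w w'
    have := hxy (w'⁻¹ * w)
    simpa only [map_mul, map_inv, Equiv.Perm.mul_apply, Equiv.Perm.inv_eq_iff_eq] using this
  have hnew : ∀ w, act τ w y ∉ A.image f := by
    intro w hw
    obtain ⟨z, hz, hzw⟩ := Finset.mem_image.1 hw
    refine hy (Finset.mem_image.2 ⟨act σ w⁻¹ z, h.mapsTo z hz _, ?_⟩)
    rw [h.equivariant z hz, hzw, map_inv]
    simp
  choose! g hg using fun z (hz : z ∈ O) => memO.1 hz
  set f' : Fin n → Fin n := fun z => if z ∈ O then act τ (g z) y else f z with hf'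
  have hfO : ∀ w, f' (act σ w x) = act τ w y := by
    intro w
    rw [hf']
    simp only [hxO w, if_true]
    exact (hrel _ _).1 (hg _ (hxO w))
  have hfA : ∀ z ∈ A, f' z = f z := by
    intro z hz
    have : z ∉ O := fun hzO => hdisj z hzO hz
    simp [hf', this]
  refine ⟨A ∪ O, f', ⟨?_, ?_, ?_⟩, Finset.ssubset_iff_of_subset Finset.subset_union_left |>.2
    ⟨x, Finset.mem_union_right _ (by simpa using hxO 1), hx⟩⟩
  · intro z hz w
    rcases Finset.mem_union.1 hz with hz | hz
    · exact Finset.mem_union_left _ (h.mapsTo z hz w)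
    · obtain ⟨v, rfl⟩ := memO.1 hz
      refine Finset.mem_union_right _ ?_
      rw [← Equiv.Perm.mul_apply, ← map_mul]
      exact hxO _
  · intro z hz z' hz' hzz
    rcases Finset.mem_union.1 (Finset.mem_coe.1 hz) with hz | hz <;>
      rcases Finset.mem_union.1 (Finset.mem_coe.1 hz') with hz' | hz'
    · rw [hfA z hz, hfA z' hz'] at hzz
      exact h.injOn hz hz' hzz
    · obtain ⟨v, rfl⟩ := memO.1 hz'
      rw [hfA z hz, hfO] at hzz
      exact absurd (Finset.mem_image.2 ⟨z, hz, hzz⟩) (hnew v)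
    · obtain ⟨v, rfl⟩ := memO.1 hz
      rw [hfA z' hz', hfO] at hzz
      exact absurd (Finset.mem_image.2 ⟨z', hz', hzz.symm⟩) (hnew v)
    · obtain ⟨v, rfl⟩ := memO.1 hz
      obtain ⟨v', rfl⟩ := memO.1 hz'
      rw [hfO, hfO] at hzz
      exact (hrel _ _).2 hzz
  · intro z hz w
    rcases Finset.mem_union.1 hz with hz | hz
    · rw [hfA z hz, hfA _ (h.mapsTo z hz w), h.equivariant z hz]
    · obtain ⟨v, rfl⟩ := memO.1 hz
      rw [hfO, ← Equiv.Perm.mul_apply, ← map_mul, hfO, map_mul, Equiv.Perm.mul_apply]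

/-- If `P` separates the stabilizers of `σ` and `τ` and the traces of the stabilizers on `P` have
the same statistics, then `σ` and `τ` are conjugate. -/
theorem exists_relabel_eq {d n : ℕ} {σ τ : PermTuple d n} {P : Finset (FS d)}
    (hsep : ∀ x y, stabIn σ P x = stabIn τ P y → ∀ w, act σ w x = x ↔ act τ w y = y)
    (hcard : ∀ Y ∈ P.powerset, (Finset.univ.filter fun a => stabIn σ P a = Y).card =
      (Finset.univ.filter fun b => stabIn τ P b = Y).card) :
    ∃ π, σ = relabel π τ := by
  classical
  obtain ⟨A, hA⟩ := (Set.toFinite {A : Finset (Fin n) | ∃ f, PartialIso σ τ A f}).exists_maximal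
    ⟨∅, id, ⟨by simp, by simp, by simp⟩⟩
  obtain ⟨f, hf⟩ := hA.prop
  have huniv : ∀ x, x ∈ A := by
    by_contra! hx
    obtain ⟨x, hx⟩ := hx
    -- Inside `A` and its image the type of `x` is equally frequent, hence also outside.
    have h1 : (A.filter fun a => stabIn σ P a = stabIn σ P x).card =
        ((A.image f).filter fun b => stabIn τ P b = stabIn σ P x).card := by
      refine Finset.card_bij (fun a _ => f a) ?_ ?_ ?_
      · intro a ha
        obtain ⟨ha, ha'⟩ := Finset.mem_filter.1 ha
        exact Finset.mem_filter.2 ⟨Finset.mem_image_of_mem f ha, by rw [hf.stabIn_eq ha, ha']⟩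
      · intro a ha b hb hab
        exact hf.injOn (Finset.mem_filter.1 ha).1 (Finset.mem_filter.1 hb).1 hab
      · intro b hb
        obtain ⟨hb, hb'⟩ := Finset.mem_filter.1 hb
        obtain ⟨a, ha, rfl⟩ := Finset.mem_image.1 hb
        exact ⟨a, Finset.mem_filter.2 ⟨ha, by rw [← hf.stabIn_eq ha, hb']⟩, rfl⟩
    have h2 : (A.filter fun a => stabIn σ P a = stabIn σ P x).card <
        (Finset.univ.filter fun a => stabIn σ P a = stabIn σ P x).card :=
      Finset.card_lt_card <| (Finset.ssubset_iff_of_subset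
        (Finset.filter_subset_filter _ (Finset.subset_univ A))).2 ⟨x, by simp, by simp [hx]⟩
    rw [h1, hcard _ (stabIn_mem_powerset σ P x)] at h2
    obtain ⟨y, hy, hy'⟩ := Finset.exists_mem_notMem_of_card_lt_card h2
    have hy2 : stabIn τ P y = stabIn σ P x := (Finset.mem_filter.1 hy).2
    have hy3 : y ∉ A.image f := fun h => hy' (Finset.mem_filter.2 ⟨h, hy2⟩)
    obtain ⟨A', f', h', hlt⟩ := hf.extend hx hy3 (hsep x y hy2.symm)
    exact hlt.not_subset (hA.le_of_ge ⟨f', h'⟩ hlt.subset)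
  have hinj : Function.Injective f := fun x y h => hf.injOn (huniv x) (huniv y) h
  refine ⟨Equiv.ofBijective f (Finite.injective_iff_bijective.1 hinj), funext fun j => ?_⟩
  have := fun x => hf.equivariant x (huniv x) (FreeGroup.of j)
  simp only [act, FreeGroup.lift_apply_of] at this
  ext1 x
  rw [relabel, Equiv.Perm.mul_apply, Equiv.Perm.mul_apply, eq_comm, Equiv.Perm.inv_eq_iff_eq]
  exact (this x).symm

/-- Finitely many group elements separate all stabilizers of tuples of permutations of `Fin n`. -/
theorem exists_separating (d n : ℕ) : ∃ P₀ : Finset (FS d), ∀ P, P₀ ⊆ P →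
    ∀ (σ τ : PermTuple d n) (x y : Fin n), stabIn σ P x = stabIn τ P y →
      ∀ w, act σ w x = x ↔ act τ w y = y := by
  classical
  have h : ∀ p : (PermTuple d n × PermTuple d n) × (Fin n × Fin n), ∃ v : FS d,
      (act p.1.1 v p.2.1 = p.2.1 ↔ act p.1.2 v p.2.2 = p.2.2) →
        ∀ w, act p.1.1 w p.2.1 = p.2.1 ↔ act p.1.2 w p.2.2 = p.2.2 := by
    intro p
    by_cases hp : ∀ w, act p.1.1 w p.2.1 = p.2.1 ↔ act p.1.2 w p.2.2 = p.2.2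
    · exact ⟨1, fun _ => hp⟩
    · obtain ⟨v, hv⟩ := not_forall.1 hp
      exact ⟨v, fun h => absurd h hv⟩
  choose v hv using h
  refine ⟨Finset.univ.image v, fun P hP σ τ x y hxy => hv ((σ, τ), (x, y)) ?_⟩
  have hmem : v ((σ, τ), (x, y)) ∈ P := hP (Finset.mem_image_of_mem v (Finset.mem_univ _))
  have := Finset.ext_iff.1 hxy (v ((σ, τ), (x, y)))
  simpa only [mem_stabIn, hmem, true_and] using this

/-- For a fixed size, solutions and tuples that are far from all solutions have different local
statistics, so the statistics are at least `1 / (2 n)` apart. -/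
theorem exists_le_dTV_of_fixed {d : ℕ} (E : EqSystem d) {ε : ℝ} (hε : 0 < ε) (n : ℕ) (hn : 0 < n) :
    ∃ P₀ : Finset (FS d), ∀ P, P₀ ⊆ P → ∀ σ ∈ Sol E n, ∀ τ ∈ SolFar E ε n,
      1 / (2 * (n : ℝ)) ≤ dTV P.powerset (localStat σ P) (localStat τ P) := by
  obtain ⟨P₀, hP₀⟩ := exists_separating d n
  refine ⟨P₀, fun P hP σ hσ τ hτ => ?_⟩
  by_contra! hlt
  have hn' : (0 : ℝ) < n := Nat.cast_pos.2 hn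
  have hdiff : statDiff τ σ P < 1 := by
    have hsymm : statDiff τ σ P = statDiff σ τ P :=
      Finset.sum_congr rfl fun Y _ => abs_sub_comm _ _
    rw [hsymm, statDiff_eq hn]
    rw [lt_div_iff₀ (by positivity)] at hlt
    linarith
  obtain ⟨π, hπ⟩ := exists_relabel_eq (hP₀ P hP τ σ) fun Y hY => by
    by_contra hne
    have h1 : |((Finset.univ.filter fun a => stabIn τ P a = Y).card : ℝ) -
        (Finset.univ.filter fun b => stabIn σ P b = Y).card| ≤ statDiff τ σ P :=
      Finset.single_le_sum (f := fun Y => |((Finset.univ.filter fun a => stabIn τ P a = Y).card : ℝ)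
        - (Finset.univ.filter fun b => stabIn σ P b = Y).card|) (fun _ _ => abs_nonneg _) hY
    have h2 : (1 : ℝ) ≤ |((Finset.univ.filter fun a => stabIn τ P a = Y).card : ℝ) -
        (Finset.univ.filter fun b => stabIn σ P b = Y).card| := by
      have : (1 : ℤ) ≤ |((Finset.univ.filter fun a => stabIn τ P a = Y).card : ℤ) -
          (Finset.univ.filter fun b => stabIn σ P b = Y).card| :=
        Int.one_le_abs (by omega)
      exact_mod_cast this
    linarith
  have := hτ τ (hπ ▸ relabel_mem_sol π hσ)
  simp only [hamming_self, Finset.sum_const_zero] at this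
  linarith

/-- A testable system is statistically distinguishable. -/
theorem Testable.statisticallyDistinguishable {d : ℕ} {E : EqSystem d} (h : Testable E) :
    StatisticallyDistinguishable E := by
  classical
  intro ε hε
  obtain ⟨q, M, hM⟩ := h ε hε
  obtain ⟨n₀, δ, hδ, hlarge⟩ := exists_le_dTV_of_large d q
  choose! Q hQ using fun n (hn : 0 < n) => exists_le_dTV_of_fixed E hε n hn
  refine ⟨ball d (2 * q) ∪ (Finset.range n₀).biUnion Q, min δ (1 / (2 * (n₀ + 1))),
    by positivity, fun n hn σ hσ τ hτ => ?_⟩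
  rcases le_or_gt n₀ n with hle | hlt
  · refine (min_le_left _ _).trans (hlarge _ Finset.subset_union_left n hle hn (M n)
      (hM.queries n hn) σ τ ?_ ?_)
    · exact fun π => hM.completeness n hn _ (relabel_mem_sol π hσ)
    · exact fun π => hM.soundness n hn _ (relabel_mem_solFar π hτ)
  · refine (min_le_right _ _).trans (le_trans ?_ (hQ n hn _ ?_ σ hσ τ hτ))
    · have hn' : (0 : ℝ) < n := Nat.cast_pos.2 hn
      have : (n : ℝ) ≤ n₀ + 1 := by exact_mod_cast hlt.le.trans (Nat.le_succ _)
      gcongr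
    · exact (Finset.subset_biUnion_of_mem Q (Finset.mem_range.2 hlt)).trans
        Finset.subset_union_right

/-! ### The distribution of the samples of the Local Statistics Matcher -/

/-- The average of `F` over all lists of `k` elements of `Fin n`. -/
noncomputable def avgList (n : ℕ) : ℕ → (List (Fin n) → ℝ) → ℝ
  | 0, F => F []
  | k + 1, F => (∑ x : Fin n, avgList n k fun xs => F (x :: xs)) / (n : ℝ)

theorem avgList_mono {n k : ℕ} {F G : List (Fin n) → ℝ}
    (h : ∀ xs, xs.length = k → F xs ≤ G xs) : avgList n k F ≤ avgList n k G := by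
  induction k generalizing F G with
  | zero => exact h [] rfl
  | succ k ih =>
    simp only [avgList]
    refine div_le_div_of_nonneg_right (Finset.sum_le_sum fun x _ => ih fun xs hxs => ?_)
      (Nat.cast_nonneg n)
    exact h _ (by simp [hxs])

theorem avgList_add {n k : ℕ} (F G : List (Fin n) → ℝ) :
    avgList n k (fun xs => F xs + G xs) = avgList n k F + avgList n k G := by
  induction k generalizing F G with
  | zero => rfl
  | succ k ih => simp only [avgList, ih, Finset.sum_add_distrib, add_div]

theorem avgList_const_mul {n k : ℕ} (c : ℝ) (F : List (Fin n) → ℝ) :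
    avgList n k (fun xs => c * F xs) = c * avgList n k F := by
  induction k generalizing F with
  | zero => rfl
  | succ k ih => simp only [avgList, ih, ← Finset.mul_sum, mul_div_assoc]

theorem avgList_const {n k : ℕ} (hn : 0 < n) (c : ℝ) : avgList n k (fun _ => c) = c := by
  have hn' : (n : ℝ) ≠ 0 := Nat.cast_ne_zero.2 hn.ne'
  induction k with
  | zero => rfl
  | succ k ih =>
    simp only [avgList, ih, Finset.sum_const, Finset.card_univ, Fintype.card_fin, nsmul_eq_mul]
    field_simp

theorem avgList_finset_sum {ι : Type*} {n k : ℕ} (s : Finset ι) (F : ι → List (Fin n) → ℝ) :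
    avgList n k (fun xs => ∑ i ∈ s, F i xs) = ∑ i ∈ s, avgList n k (F i) := by
  induction k generalizing F with
  | zero => rfl
  | succ k ih =>
    simp only [avgList, ih]
    rw [Finset.sum_comm, Finset.sum_div]

/-- The second moment of a sum of independent centred variables. -/
theorem avgList_sq {n : ℕ} (hn : 0 < n) {g : Fin n → ℝ} (hg : ∑ x, g x = 0) (k : ℕ) (c : ℝ) :
    avgList n k (fun xs => (c + (xs.map g).sum) ^ 2) = c ^ 2 + k * ((∑ x, g x ^ 2) / n) := by
  have hn' : (n : ℝ) ≠ 0 := Nat.cast_ne_zero.2 hn.ne'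
  induction k generalizing c with
  | zero => simp [avgList]
  | succ k ih =>
    have h : ∀ x, avgList n k (fun xs => (c + ((x :: xs).map g).sum) ^ 2) =
        c ^ 2 + 2 * c * g x + g x ^ 2 + k * ((∑ x, g x ^ 2) / n) := by
      intro x
      rw [show c ^ 2 + 2 * c * g x + g x ^ 2 = (c + g x) ^ 2 by ring, ← ih]
      simp only [List.map_cons, List.sum_cons, add_assoc]
    simp only [avgList, h, Finset.sum_add_distrib, ← Finset.mul_sum, hg]
    simp only [Finset.sum_const, Finset.card_univ, Fintype.card_fin, nsmul_eq_mul]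
    field_simp
    push_cast
    ring

theorem uniformLaw_get_map {ι α : Type*} [DecidableEq α] (f : ι → α) (xs : List ι) (Y : α) :
    uniformLaw (xs.map f).get Y = (xs.map fun x => if f x = Y then (1 : ℝ) else 0).sum /
      (xs.length : ℝ) := by
  have h := Fin.sum_univ_fun_getElem (xs.map f) fun y => if y = Y then (1 : ℝ) else 0
  rw [List.map_map] at h
  rw [uniformLaw, Fintype.card_fin, Finset.card_filter, Nat.cast_sum]
  congr 1
  · simpa [Function.comp_def] using h
  · rw [List.length_map]

theorem list_sum_map_sub_const {ι : Type*} (h : ι → ℝ) (p : ℝ) (xs : List ι) :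
    (xs.map fun x => h x - p).sum = (xs.map h).sum - xs.length * p := by
  induction xs with
  | nil => simp
  | cons x xs ih =>
    simp only [List.map_cons, List.sum_cons, ih, List.length_cons]
    push_cast
    ring

/-- The mean square deviation of the empirical frequency of `Y` is at most `1 / k`. -/
theorem avgList_sq_sub_le {α : Type*} [DecidableEq α] {n k : ℕ} (hn : 0 < n) (hk : 0 < k)
    (f : Fin n → α) (Y : α) :
    avgList n k (fun xs => (uniformLaw (xs.map f).get Y - uniformLaw f Y) ^ 2) ≤ 1 / k := by
  have hn' : (0 : ℝ) < n := Nat.cast_pos.2 hn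
  have hk' : (0 : ℝ) < k := Nat.cast_pos.2 hk
  set p := uniformLaw f Y with hp
  have hp' : p = (∑ x, if f x = Y then (1 : ℝ) else 0) / n := by
    simp [hp, uniformLaw]
  have hp0 : 0 ≤ p := by
    rw [hp']
    exact div_nonneg (Finset.sum_nonneg fun _ _ => by split <;> norm_num) hn'.le
  have hp1 : p ≤ 1 := by
    rw [hp', div_le_one hn']
    calc _ ≤ ∑ x : Fin n, (1 : ℝ) := Finset.sum_le_sum fun _ _ => by split <;> norm_num
      _ = n := by simp
  set g : Fin n → ℝ := fun x => (if f x = Y then (1 : ℝ) else 0) - p with hg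
  have hg0 : ∑ x, g x = 0 := by
    simp only [hg, Finset.sum_sub_distrib, hp']
    simp only [Finset.sum_const, Finset.card_univ, Fintype.card_fin, nsmul_eq_mul]
    field_simp
    ring
  have hV : (∑ x, g x ^ 2) / n ≤ 1 := by
    rw [div_le_one hn']
    calc ∑ x, g x ^ 2 ≤ ∑ x : Fin n, (1 : ℝ) := by
          refine Finset.sum_le_sum fun x _ => ?_
          simp only [hg]
          split <;> nlinarith
      _ = n := by simp
  calc _ ≤ avgList n k (fun xs => 1 / (k : ℝ) ^ 2 * (0 + (xs.map g).sum) ^ 2) := by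
        refine avgList_mono fun xs hxs => le_of_eq ?_
        rw [uniformLaw_get_map, list_sum_map_sub_const, hxs]
        field_simp
        ring
    _ = 1 / (k : ℝ) ^ 2 * (k * ((∑ x, g x ^ 2) / n)) := by
        rw [avgList_const_mul, avgList_sq hn hg0]
        ring
    _ ≤ 1 / (k : ℝ) ^ 2 * (k * 1) := by gcongr
    _ = 1 / k := by field_simp

theorem dTV_comm {α : Type*} (Ω : Finset α) (θ₁ θ₂ : α → ℝ) : dTV Ω θ₁ θ₂ = dTV Ω θ₂ θ₁ := by
  simp only [dTV, abs_sub_comm]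

theorem dTV_triangle {α : Type*} (Ω : Finset α) (θ₁ θ₂ θ₃ : α → ℝ) :
    dTV Ω θ₁ θ₃ ≤ dTV Ω θ₁ θ₂ + dTV Ω θ₂ θ₃ := by
  simp only [dTV]
  rw [← mul_add, ← Finset.sum_add_distrib]
  gcongr
  exact abs_sub_le _ _ _

theorem sq_dTV_le {α : Type*} (Ω : Finset α) (θ₁ θ₂ : α → ℝ) :
    4 * dTV Ω θ₁ θ₂ ^ 2 ≤ Ω.card * ∑ a ∈ Ω, (θ₁ a - θ₂ a) ^ 2 := by
  have h := sq_sum_le_card_mul_sum_sq (s := Ω) (f := fun a => |θ₁ a - θ₂ a|)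
  simp only [sq_abs] at h
  rw [dTV]
  linarith

/-- Enough samples have an empirical law close to the true law with probability at least
`99 / 100`: Chebyshev's inequality for each atom. -/
theorem le_avgList_of_close {α : Type*} [DecidableEq α] {n k : ℕ} (hn : 0 < n) (hk : 0 < k)
    (f : Fin n → α) (Ω : Finset α) {η : ℝ} (hη : 0 < η)
    (hkη : 25 * (Ω.card : ℝ) ^ 2 ≤ k * η ^ 2) (V : List (Fin n) → ℝ) (hV0 : ∀ xs, 0 ≤ V xs)
    (hV : ∀ xs, dTV Ω (uniformLaw (xs.map f).get) (uniformLaw f) ≤ η → V xs = 1) :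
    (0.99 : ℝ) ≤ avgList n k V := by
  have hk' : (0 : ℝ) < k := Nat.cast_pos.2 hk
  have h1 : avgList n k (fun xs => 1 + -(Ω.card / (4 * η ^ 2)) *
      ∑ Y ∈ Ω, (uniformLaw (xs.map f).get Y - uniformLaw f Y) ^ 2) ≤ avgList n k V := by
    refine avgList_mono fun xs _ => ?_
    have hs : 0 ≤ ∑ Y ∈ Ω, (uniformLaw (xs.map f).get Y - uniformLaw f Y) ^ 2 :=
      Finset.sum_nonneg fun _ _ => sq_nonneg _
    rcases le_or_gt (dTV Ω (uniformLaw (xs.map f).get) (uniformLaw f)) η with h | h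
    · rw [hV xs h]
      have : 0 ≤ Ω.card / (4 * η ^ 2) *
          ∑ Y ∈ Ω, (uniformLaw (xs.map f).get Y - uniformLaw f Y) ^ 2 := by positivity
      linarith
    · refine le_trans ?_ (hV0 xs)
      have h2 := sq_dTV_le Ω (uniformLaw (xs.map f).get) (uniformLaw f)
      have h3 : η ^ 2 ≤ dTV Ω (uniformLaw (xs.map f).get) (uniformLaw f) ^ 2 := by gcongr
      have h4 : 1 ≤ Ω.card / (4 * η ^ 2) *
          ∑ Y ∈ Ω, (uniformLaw (xs.map f).get Y - uniformLaw f Y) ^ 2 := by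
        rw [div_mul_eq_mul_div, le_div_iff₀ (by positivity)]
        linarith
      linarith
  refine le_trans ?_ h1
  rw [avgList_add, avgList_const hn, avgList_const_mul, avgList_finset_sum]
  have h2 : ∑ Y ∈ Ω, avgList n k (fun xs => (uniformLaw (xs.map f).get Y - uniformLaw f Y) ^ 2) ≤
      Ω.card * (1 / k) := by
    rw [← nsmul_eq_mul]
    exact Finset.sum_le_card_nsmul _ _ _ fun Y _ => avgList_sq_sub_le hn hk f Y
  have h3 : Ω.card / (4 * η ^ 2) * (Ω.card * (1 / k)) ≤ (0.01 : ℝ) := by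
    rw [show (Ω.card / (4 * η ^ 2) * (Ω.card * (1 / k)) : ℝ) = (Ω.card : ℝ) ^ 2 / (4 * (k * η ^ 2))
      by field_simp, div_le_iff₀ (by positivity)]
    linarith
  have h4 := mul_le_mul_of_nonneg_left h2 (show 0 ≤ Ω.card / (4 * η ^ 2) by positivity)
  linarith

/-! ### Acceptance probability and number of queries of the Local Statistics Matcher -/

theorem prob_sampleMany {d n : ℕ} (hn : 0 < n) (σ : PermTuple d n) (b : Bool) (k : ℕ)
    (c : List (Fin n) → Tree d n) :
    (sampleMany hn k c).prob σ b = avgList n k fun xs => (c xs).prob σ b := by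
  induction k generalizing c with
  | zero => rfl
  | succ k ih => simp only [sampleMany, Tree.prob, avgList, ih]

theorem queryCount_sampleMany_le {d n : ℕ} (hn : 0 < n) (σ : PermTuple d n) (k : ℕ) {B : ℕ}
    {c : List (Fin n) → Tree d n} (hc : ∀ xs, xs.length = k → (c xs).queryCount σ ≤ B) :
    (sampleMany hn k c).queryCount σ ≤ B := by
  induction k generalizing c with
  | zero => exact hc [] rfl
  | succ k ih =>
    simp only [sampleMany, Tree.queryCount]
    exact Finset.sup_le fun x _ => ih fun xs hxs => hc _ (by simp [hxs])

theorem wordEval_cons {d n : ℕ} (σ : PermTuple d n) (l : Fin d × Bool) (w : Word d) :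
    wordEval σ (l :: w) = letterEval σ l * wordEval σ w := by
  simp [wordEval]

theorem prob_queryWord {d n : ℕ} (σ : PermTuple d n) (b : Bool) (w : Word d) (x : Fin n)
    (c : Fin n → Tree d n) :
    (queryWord w x c).prob σ b = (c (wordEval σ w x)).prob σ b := by
  induction w generalizing c with
  | nil => rfl
  | cons l w ih => rw [queryWord, ih, Tree.prob, wordEval_cons]; rfl

theorem queryCount_queryWord {d n : ℕ} (σ : PermTuple d n) (w : Word d) (x : Fin n)
    (c : Fin n → Tree d n) :
    (queryWord w x c).queryCount σ = (c (wordEval σ w x)).queryCount σ + w.length := by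
  induction w generalizing c with
  | nil => rfl
  | cons l w ih =>
    rw [queryWord, ih, Tree.queryCount, wordEval_cons, List.length_cons, add_right_comm, add_assoc]
    rfl

theorem prob_queryStab {d n : ℕ} (σ : PermTuple d n) (b : Bool) (ws : List (FS d)) (x : Fin n)
    (c : Finset (FS d) → Tree d n) :
    (queryStab ws x c).prob σ b = (c (stabIn σ ws.toFinset x)).prob σ b := by
  induction ws generalizing c with
  | nil => rfl
  | cons w ws ih =>
    rw [queryStab, prob_queryWord, ih, stabIn, List.toFinset_cons, stabIn, Finset.filter_insert]

theorem queryCount_queryStab {d n : ℕ} (σ : PermTuple d n) (ws : List (FS d)) (x : Fin n)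
    (c : Finset (FS d) → Tree d n) :
    (queryStab ws x c).queryCount σ =
      (c (stabIn σ ws.toFinset x)).queryCount σ + (ws.map FreeGroup.norm).sum := by
  induction ws generalizing c with
  | nil => rfl
  | cons w ws ih =>
    rw [queryStab, queryCount_queryWord, ih, stabIn, List.toFinset_cons, stabIn,
      Finset.filter_insert, List.map_cons, List.sum_cons, add_assoc, add_comm (List.sum _)]
    rfl

theorem prob_queryStabs {d n : ℕ} (σ : PermTuple d n) (b : Bool) (P : Finset (FS d))
    (xs : List (Fin n)) (c : List (Finset (FS d)) → Tree d n) :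
    (queryStabs P xs c).prob σ b = (c (xs.map (stabIn σ P))).prob σ b := by
  induction xs generalizing c with
  | nil => rfl
  | cons x xs ih => rw [queryStabs, prob_queryStab, ih, Finset.toList_toFinset, List.map_cons]

theorem queryCount_queryStabs {d n : ℕ} (σ : PermTuple d n) (P : Finset (FS d))
    (xs : List (Fin n)) (c : List (Finset (FS d)) → Tree d n) :
    (queryStabs P xs c).queryCount σ = (c (xs.map (stabIn σ P))).queryCount σ +
      xs.length * (P.toList.map FreeGroup.norm).sum := by
  induction xs generalizing c with
  | nil => simp [queryStabs]
  | cons x xs ih =>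
    rw [queryStabs, queryCount_queryStab, ih, Finset.toList_toFinset, List.map_cons,
      List.length_cons, Nat.succ_mul, add_assoc]

open Classical in
theorem prob_LSM {d n : ℕ} (hn : 0 < n) (E : EqSystem d) (k : ℕ) (P : Finset (FS d)) (δ : ℝ)
    (σ : PermTuple d n) (b : Bool) :
    (LSM E k P δ n).prob σ b = avgList n k fun xs =>
      if decide (∃ τ ∈ Sol E n, dTV P.powerset (uniformLaw (xs.map (stabIn σ P)).get)
        (localStat τ P) ≤ δ) = b then 1 else 0 := by
  rw [LSM, dif_pos hn, prob_sampleMany]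
  simp only [prob_queryStabs, Tree.prob]

theorem queryCount_LSM_le {d n : ℕ} (hn : 0 < n) (E : EqSystem d) (k : ℕ) (P : Finset (FS d))
    (δ : ℝ) (σ : PermTuple d n) :
    (LSM E k P δ n).queryCount σ ≤ k * (P.toList.map FreeGroup.norm).sum := by
  rw [LSM, dif_pos hn]
  refine queryCount_sampleMany_le hn σ k fun xs hxs => ?_
  rw [queryCount_queryStabs, hxs, Tree.queryCount, zero_add]

open Classical in
/-- With a proximity parameter at most a third of the gap between the statistics and with enough
samples, the Local Statistics Matcher errs with probability at most `1 / 100`. -/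
theorem isTester_LSM {d : ℕ} {E : EqSystem d} {ε δ₀ δ : ℝ} {k : ℕ} {P : Finset (FS d)}
    (hdist : ∀ n : ℕ, 0 < n → ∀ σ ∈ Sol E n, ∀ τ ∈ SolFar E ε n,
      δ₀ ≤ dTV P.powerset (localStat σ P) (localStat τ P))
    (hδ : 0 < δ) (hδ₀ : 3 * δ ≤ δ₀) (hk : 0 < k)
    (hkδ : 25 * (P.powerset.card : ℝ) ^ 2 ≤ k * δ ^ 2) (halg : (LSM E k P δ).IsAlgorithm) :
    IsTester E ε (k * (P.toList.map FreeGroup.norm).sum) (LSM E k P δ) where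
  algorithm := halg
  completeness n hn σ hσ := by
    rw [prob_LSM hn]
    refine le_avgList_of_close hn hk (stabIn σ P) P.powerset hδ hkδ _
      (fun xs => by split <;> norm_num) fun xs hxs => ?_
    exact if_pos (decide_eq_true ⟨σ, hσ, hxs⟩)
  soundness n hn σ hσ := by
    rw [prob_LSM hn]
    refine le_avgList_of_close hn hk (stabIn σ P) P.powerset hδ hkδ _
      (fun xs => by split <;> norm_num) fun xs hxs => ?_
    refine if_pos (decide_eq_false ?_)
    rintro ⟨τ, hτ, h⟩
    have h1 := hdist n hn τ hτ σ hσ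
    have h2 := dTV_triangle P.powerset (localStat τ P) (uniformLaw (xs.map (stabIn σ P)).get)
      (localStat σ P)
    rw [dTV_comm _ (localStat τ P) (uniformLaw _)] at h2
    have h3 : dTV P.powerset (uniformLaw (xs.map (stabIn σ P)).get) (localStat σ P) ≤ δ := hxs
    linarith
  queries n hn σ := queryCount_LSM_le hn E k P δ σ

/-! ### Deciding the acceptance condition of the Local Statistics Matcher -/

theorem primrecPred_forall_mem_finset {α ι : Type} [Primcodable α] (s : Finset ι)
    {R : ι → α → Prop} (h : ∀ i, PrimrecPred (R i)) : PrimrecPred fun a => ∀ i ∈ s, R i a := by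
  classical
  induction s using Finset.induction_on with
  | empty => exact ⟨fun _ => .isTrue (by simp), (Primrec.const true).of_eq fun a => by simp⟩
  | insert i s _ ih => exact ((h i).and ih).of_eq fun a => by simp

theorem primrec_sum_finset {α ι : Type} [Primcodable α] (s : Finset ι) {f : ι → α → ℕ}
    (h : ∀ i, Primrec (f i)) : Primrec fun a => ∑ i ∈ s, f i a := by
  classical
  induction s using Finset.induction_on with
  | empty => exact (Primrec.const 0).of_eq fun a => by simp
  | insert i s hi ih =>
    exact (Primrec.nat_add.comp (h i) ih).of_eq fun a => by rw [Finset.sum_insert hi]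

theorem primrecPred_forall_lt {α : Type} [Primcodable α] {N : α → ℕ} (hN : Primrec N)
    {R : α → ℕ → Prop} (h : PrimrecRel R) : PrimrecPred fun a => ∀ x < N a, R a x := by
  have h' : PrimrecRel fun (x : ℕ) (a : α) => R a x := h.comp Primrec.snd Primrec.fst
  exact (h'.forall_mem_list.comp (Primrec.list_range.comp hN) Primrec.id).of_eq fun a => by simp

theorem primrecPred_exists_lt {α : Type} [Primcodable α] {N : α → ℕ} (hN : Primrec N)
    {R : α → ℕ → Prop} (h : PrimrecRel R) : PrimrecPred fun a => ∃ x < N a, R a x := by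
  have h' : PrimrecRel fun (x : ℕ) (a : α) => R a x := h.comp Primrec.snd Primrec.fst
  exact (h'.exists_mem_list.comp (Primrec.list_range.comp hN) Primrec.id).of_eq fun a => by simp

open Classical in
theorem primrec_card_filter_range {α : Type} [Primcodable α] {N : α → ℕ} (hN : Primrec N)
    {R : α → ℕ → Prop} (h : PrimrecRel R) :
    Primrec fun a => ((Finset.range (N a)).filter (R a)).card := by
  have h' : PrimrecRel fun (x : ℕ) (a : α) => R a x := h.comp Primrec.snd Primrec.fst
  refine (Primrec.list_length.comp
    (h'.listFilter.comp (Primrec.list_range.comp hN) Primrec.id)).of_eq fun a => ?_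
  rfl

/-- The position of a letter in a list of all `d * 2` letters. -/
def letterIndex {d : ℕ} (l : Fin d × Bool) : Fin (d * 2) :=
  finProdFinEquiv (l.1, if l.2 then 1 else 0)

/-- The digits of `c` in base `n`, read as the tables of values of the `d * 2` letters. -/
def digit {d : ℕ} (n c : ℕ) (l : Fin d × Bool) (x : ℕ) : ℕ :=
  c / n ^ (x + n * letterIndex l) % n

/-- The value of a word when the letters act by the tables stored in `c`. -/
def digitWord {d : ℕ} (n c : ℕ) : Word d → ℕ → ℕ
  | [], x => x
  | l :: w, x => digit n c l (digitWord n c w x)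

/-- The digits of `c` are the values of the letters under the substitution `σ`. -/
def Represents {d n : ℕ} (c : ℕ) (σ : PermTuple d n) : Prop :=
  ∀ (l : Fin d × Bool) (x : Fin n), digit n c l x = letterEval σ l x

theorem exists_represents {d n : ℕ} (σ : PermTuple d n) :
    ∃ c < n ^ (d * 2 * n), Represents c σ := by
  set F : Fin (d * 2 * n) → Fin n := fun i =>
    letterEval σ ((finProdFinEquiv.symm (finProdFinEquiv.symm i).1).1,
      (finProdFinEquiv.symm (finProdFinEquiv.symm i).1).2 = 1) (finProdFinEquiv.symm i).2 with hF
  refine ⟨finFunctionFinEquiv F, (finFunctionFinEquiv F).2, fun l x => ?_⟩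
  have h1 : F (finProdFinEquiv (letterIndex l, x)) = letterEval σ l x := by
    simp only [hF, Equiv.symm_apply_apply, letterIndex]
    rcases l with ⟨j, _ | _⟩ <;> simp
  have h2 : finFunctionFinEquiv.symm (finFunctionFinEquiv F) (finProdFinEquiv (letterIndex l, x)) =
    letterEval σ l x := by rw [Equiv.symm_apply_apply, h1]
  rw [← h2]
  rfl

theorem digitWord_eq {d n : ℕ} {c : ℕ} {σ : PermTuple d n} (h : Represents c σ) (w : Word d)
    (x : Fin n) : digitWord n c w x = wordEval σ w x := by
  induction w with
  | nil => simp [digitWord, wordEval]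
  | cons l w ih => rw [digitWord, ih, h, wordEval_cons, Equiv.Perm.mul_apply]

theorem exists_of_digit_inverse {d n : ℕ} (hn : 0 < n) {c : ℕ}
    (h : ∀ l ∈ (Finset.univ : Finset (Fin d × Bool)), ∀ x < n,
      digit n c (l.1, !l.2) (digit n c l x) = x) :
    ∃ σ : PermTuple d n, Represents c σ := by
  have hlt : ∀ (l : Fin d × Bool) (x : ℕ), digit n c l x < n := fun l x => Nat.mod_lt _ hn
  refine ⟨fun j => ⟨fun x => ⟨digit n c (j, true) x, hlt _ _⟩,
    fun x => ⟨digit n c (j, false) x, hlt _ _⟩, fun x => ?_, fun x => ?_⟩, ?_⟩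
  · exact Fin.ext (h (j, true) (Finset.mem_univ _) x x.2)
  · exact Fin.ext (h (j, false) (Finset.mem_univ _) x x.2)
  · rintro ⟨j, _ | _⟩ x
    · rfl
    · rfl

theorem Represents.digit_inverse {d n : ℕ} {c : ℕ} {σ : PermTuple d n} (h : Represents c σ)
    (l : Fin d × Bool) {x : ℕ} (hx : x < n) : digit n c (l.1, !l.2) (digit n c l x) = x := by
  rw [h l ⟨x, hx⟩, h]
  rcases l with ⟨j, _ | _⟩ <;> simp [letterEval]

theorem primrec_digit {d : ℕ} (l : Fin d × Bool) {α : Type} [Primcodable α] {n c x : α → ℕ}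
    (hn : Primrec n) (hc : Primrec c) (hx : Primrec x) :
    Primrec fun a => digit (n a) (c a) l (x a) := by
  have hpow : Primrec₂ ((· ^ ·) : ℕ → ℕ → ℕ) := Primrec₂.unpaired'.1 Nat.Primrec.pow
  exact Primrec.nat_mod.comp (Primrec.nat_div.comp hc (hpow.comp hn
    (Primrec.nat_add.comp hx (Primrec.nat_mul.comp hn (Primrec.const _))))) hn

theorem primrec_digitWord {d : ℕ} (w : Word d) {α : Type} [Primcodable α] {n c x : α → ℕ}
    (hn : Primrec n) (hc : Primrec c) (hx : Primrec x) :
    Primrec fun a => digitWord (n a) (c a) w (x a) := by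
  induction w with
  | nil => exact hx
  | cons l w ih => exact primrec_digit l hn hc ih

/-- The set of the `w ∈ P` that fix `x` is `Y`, when the letters act by the tables in `c`. -/
def DigitStabEq {d : ℕ} (P Y : Finset (FS d)) (n c x : ℕ) : Prop :=
  ∀ w ∈ P, (digitWord n c w.toWord x = x ↔ w ∈ Y)

theorem primrecRel_digitStabEq {d : ℕ} (P Y : Finset (FS d)) :
    PrimrecRel fun (q : ℕ × ℕ) (x : ℕ) => DigitStabEq P Y q.1 q.2 x := by
  refine primrecPred_forall_mem_finset P fun w => ?_
  have h : PrimrecPred fun a : (ℕ × ℕ) × ℕ => digitWord a.1.1 a.1.2 w.toWord a.2 = a.2 :=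
    Primrec.eq.comp (primrec_digitWord _ (Primrec.fst.comp Primrec.fst)
      (Primrec.snd.comp Primrec.fst) Primrec.snd) Primrec.snd
  by_cases hw : w ∈ Y
  · exact h.of_eq fun a => by simp [hw]
  · exact h.not.of_eq fun a => by simp [hw]

theorem digitStabEq_iff {d n : ℕ} {c : ℕ} {σ : PermTuple d n} (h : Represents c σ)
    {P Y : Finset (FS d)} (hY : Y ∈ P.powerset) (x : Fin n) :
    DigitStabEq P Y n c x ↔ stabIn σ P x = Y := by
  have hY := Finset.mem_powerset.1 hY
  have h1 : ∀ w : FS d, digitWord n c w.toWord x = x ↔ act σ w x = x := by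
    intro w
    rw [digitWord_eq h, wordEval_toWord, Fin.ext_iff]
  simp only [DigitStabEq, h1]
  constructor
  · intro h2
    ext w
    rw [mem_stabIn]
    exact ⟨fun hw => (h2 w hw.1).1 hw.2, fun hw => ⟨hY hw, (h2 w (hY hw)).2 hw⟩⟩
  · rintro rfl w hw
    rw [mem_stabIn]
    exact ⟨fun h => ⟨hw, h⟩, fun h => h.2⟩

open Classical in
/-- The number of the `x < n` whose stabilizer has trace `Y` on `P`, computed from the tables. -/
noncomputable def digitCount {d : ℕ} (P Y : Finset (FS d)) (q : ℕ × ℕ) : ℕ :=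
  ((Finset.range q.1).filter (DigitStabEq P Y q.1 q.2)).card

theorem primrec_digitCount {d : ℕ} (P Y : Finset (FS d)) : Primrec (digitCount P Y) :=
  primrec_card_filter_range (α := ℕ × ℕ) Primrec.fst (primrecRel_digitStabEq P Y)

theorem digitCount_eq {d n : ℕ} {c : ℕ} {σ : PermTuple d n} (h : Represents c σ)
    {P Y : Finset (FS d)} (hY : Y ∈ P.powerset) :
    digitCount P Y (n, c) = (Finset.univ.filter fun x => stabIn σ P x = Y).card := by
  classical
  symm
  refine Finset.card_bij (fun x _ => (x : ℕ)) ?_ ?_ ?_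
  · intro x hx
    rw [Finset.mem_filter] at hx ⊢
    exact ⟨Finset.mem_range.2 x.2, (digitStabEq_iff h hY x).2 hx.2⟩
  · intro x _ y _ hxy
    exact Fin.ext hxy
  · intro x hx
    rw [Finset.mem_filter] at hx
    exact ⟨⟨x, Finset.mem_range.1 hx.1⟩,
      Finset.mem_filter.2 ⟨Finset.mem_univ _, (digitStabEq_iff h hY _).1 hx.2⟩, rfl⟩

/-- The condition that the base-`n` digits of `c` are the tables of a solution of `E` whose local
statistics are within `1 / M` of the law with masses `m Y / K`. -/
def DigitAccept {d : ℕ} (E : EqSystem d) (P : Finset (FS d)) (m : Finset (FS d) → ℕ) (K M : ℕ)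
    (n c : ℕ) : Prop :=
  (∀ l ∈ (Finset.univ : Finset (Fin d × Bool)), ∀ x < n,
      digit n c (l.1, !l.2) (digit n c l x) = x) ∧
    (∀ e ∈ E, ∀ x < n, digitWord n c e.1 x = digitWord n c e.2 x) ∧
    M * ∑ Y ∈ P.powerset, ((m Y * n - K * digitCount P Y (n, c)) +
      (K * digitCount P Y (n, c) - m Y * n)) ≤ 2 * (K * n)

theorem primrecRel_digitAccept {d : ℕ} (E : EqSystem d) (P : Finset (FS d))
    (m : Finset (FS d) → ℕ) (K M : ℕ) : PrimrecRel (DigitAccept E P m K M) := by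
  refine PrimrecPred.and ?_ (PrimrecPred.and ?_ ?_)
  · refine primrecPred_forall_mem_finset _ fun l => primrecPred_forall_lt Primrec.fst ?_
    have hn : Primrec fun a : (ℕ × ℕ) × ℕ => a.1.1 := Primrec.fst.comp Primrec.fst
    have hc : Primrec fun a : (ℕ × ℕ) × ℕ => a.1.2 := Primrec.snd.comp Primrec.fst
    exact Primrec.eq.comp (primrec_digit _ hn hc (primrec_digit l hn hc Primrec.snd)) Primrec.snd
  · refine primrecPred_forall_mem_finset _ fun e => primrecPred_forall_lt Primrec.fst ?_
    have hn : Primrec fun a : (ℕ × ℕ) × ℕ => a.1.1 := Primrec.fst.comp Primrec.fst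
    have hc : Primrec fun a : (ℕ × ℕ) × ℕ => a.1.2 := Primrec.snd.comp Primrec.fst
    exact Primrec.eq.comp (primrec_digitWord _ hn hc Primrec.snd)
      (primrec_digitWord _ hn hc Primrec.snd)
  · refine Primrec.nat_le.comp (Primrec.nat_mul.comp (Primrec.const M)
      (primrec_sum_finset _ fun Y => ?_)) (Primrec.nat_mul.comp (Primrec.const 2)
        (Primrec.nat_mul.comp (Primrec.const K) Primrec.fst))
    have h1 : Primrec fun q : ℕ × ℕ => m Y * q.1 :=
      Primrec.nat_mul.comp (Primrec.const _) Primrec.fst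
    have h2 : Primrec fun q : ℕ × ℕ => K * digitCount P Y q :=
      Primrec.nat_mul.comp (Primrec.const _) (primrec_digitCount P Y)
    exact Primrec.nat_add.comp (Primrec.nat_sub.comp h1 h2) (Primrec.nat_sub.comp h2 h1)

theorem dTV_le_iff {d n : ℕ} (hn : 0 < n) (σ : PermTuple d n) (P : Finset (FS d))
    (m : Finset (FS d) → ℕ) {K M : ℕ} (hK : 0 < K) (hM : 0 < M) :
    dTV P.powerset (fun Y => (m Y : ℝ) / K) (localStat σ P) ≤ 1 / (M : ℝ) ↔
      M * ∑ Y ∈ P.powerset,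
        ((m Y * n - K * (Finset.univ.filter fun x => stabIn σ P x = Y).card) +
          (K * (Finset.univ.filter fun x => stabIn σ P x = Y).card - m Y * n)) ≤ 2 * (K * n) := by
  have hn' : (0 : ℝ) < n := Nat.cast_pos.2 hn
  have hK' : (0 : ℝ) < K := Nat.cast_pos.2 hK
  have hM' : (0 : ℝ) < M := Nat.cast_pos.2 hM
  have hsub : ∀ a b : ℕ, (((a - b) + (b - a) : ℕ) : ℝ) = |(a : ℝ) - b| := by
    intro a b
    rcases le_total a b with h | h
    · rw [Nat.sub_eq_zero_of_le h, zero_add, Nat.cast_sub h, abs_sub_comm, abs_of_nonneg]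
      exact sub_nonneg.2 (Nat.cast_le.2 h)
    · rw [Nat.sub_eq_zero_of_le h, add_zero, Nat.cast_sub h, abs_of_nonneg]
      exact sub_nonneg.2 (Nat.cast_le.2 h)
  have hterm : ∀ Y, |(m Y : ℝ) / K - localStat σ P Y| =
      (((m Y * n - K * (Finset.univ.filter fun x => stabIn σ P x = Y).card) +
        (K * (Finset.univ.filter fun x => stabIn σ P x = Y).card - m Y * n) : ℕ) : ℝ) /
          (K * n) := by
    intro Y
    rw [hsub, localStat, uniformLaw, Fintype.card_fin, div_sub_div _ _ hK'.ne' hn'.ne', abs_div,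
      abs_of_pos (mul_pos hK' hn')]
    push_cast
    rfl
  rw [dTV, Finset.sum_congr rfl fun Y _ => hterm Y, ← Finset.sum_div, ← Nat.cast_sum,
    ← Nat.cast_le (α := ℝ)]
  set S := ∑ Y ∈ P.powerset,
        ((m Y * n - K * (Finset.univ.filter fun x => stabIn σ P x = Y).card) +
          (K * (Finset.univ.filter fun x => stabIn σ P x = Y).card - m Y * n))
  rw [le_div_iff₀ hM', ← mul_div_assoc, div_mul_eq_mul_div, div_le_one (mul_pos hK' hn')]
  push_cast
  constructor <;> intro h <;> linarith

theorem exists_digitAccept_iff {d n : ℕ} (hn : 0 < n) (E : EqSystem d) (P : Finset (FS d))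
    (m : Finset (FS d) → ℕ) {K M : ℕ} (hK : 0 < K) (hM : 0 < M) :
    (∃ c < n ^ (d * 2 * n), DigitAccept E P m K M n c) ↔
      ∃ τ ∈ Sol E n, dTV P.powerset (fun Y => (m Y : ℝ) / K) (localStat τ P) ≤ 1 / (M : ℝ) := by
  have hcount : ∀ {c : ℕ} {τ : PermTuple d n}, Represents c τ →
      ∑ Y ∈ P.powerset, ((m Y * n - K * digitCount P Y (n, c)) +
        (K * digitCount P Y (n, c) - m Y * n)) =
      ∑ Y ∈ P.powerset,
        ((m Y * n - K * (Finset.univ.filter fun x => stabIn τ P x = Y).card) +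
          (K * (Finset.univ.filter fun x => stabIn τ P x = Y).card - m Y * n)) := by
    intro c τ h
    exact Finset.sum_congr rfl fun Y hY => by rw [digitCount_eq h hY]
  constructor
  · rintro ⟨c, _, h1, h2, h3⟩
    obtain ⟨τ, hτ⟩ := exists_of_digit_inverse hn h1
    refine ⟨τ, fun e he => Equiv.ext fun x => Fin.ext ?_, ?_⟩
    · rw [← digitWord_eq hτ, ← digitWord_eq hτ]
      exact h2 e he x x.2
    · rw [dTV_le_iff hn τ P m hK hM, ← hcount hτ]
      exact h3
  · rintro ⟨τ, hτ, h⟩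
    obtain ⟨c, hc, hcτ⟩ := exists_represents τ
    refine ⟨c, hc, fun l _ x hx => hcτ.digit_inverse l hx, fun e he x hx => ?_, ?_⟩
    · have := hτ e he
      rw [digitWord_eq hcτ e.1 ⟨x, hx⟩, digitWord_eq hcτ e.2 ⟨x, hx⟩, this]
    · rw [hcount hcτ, ← dTV_le_iff hn τ P m hK hM]
      exact h

theorem exists_uniformLaw_eq {α : Type*} [DecidableEq α] (Qs : List α) :
    ∃ (m : α → ℕ) (K : ℕ), 0 < K ∧ uniformLaw Qs.get = fun Y => (m Y : ℝ) / K := by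
  rcases Qs with _ | ⟨Q, Qs⟩
  · exact ⟨fun _ => 0, 1, one_pos, by funext Y; simp [uniformLaw]⟩
  · refine ⟨fun Y => (Finset.univ.filter fun i => (Q :: Qs).get i = Y).card, (Q :: Qs).length,
      by simp, ?_⟩
    funext Y
    rw [uniformLaw, Fintype.card_fin]

open Classical in
/-- For a fixed outcome of the sampling, the verdict is a primitive recursive function of `n`. -/
theorem primrec_verdict {d : ℕ} (E : EqSystem d) (P : Finset (FS d)) {M : ℕ} (hM : 0 < M)
    (Qs : List (Finset (FS d))) : Primrec fun n : ℕ =>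
      decide (∃ τ ∈ Sol E (n + 1),
        dTV P.powerset (uniformLaw Qs.get) (localStat τ P) ≤ 1 / (M : ℝ)) := by
  obtain ⟨m, K, hK, hQs⟩ := exists_uniformLaw_eq Qs
  have hpow : Primrec₂ ((· ^ ·) : ℕ → ℕ → ℕ) := Primrec₂.unpaired'.1 Nat.Primrec.pow
  have h1 : PrimrecPred fun n : ℕ => ∃ c < n ^ (d * 2 * n), DigitAccept E P m K M n c :=
    primrecPred_exists_lt
      (hpow.comp Primrec.id (Primrec.nat_mul.comp (Primrec.const _) Primrec.id))
      (primrecRel_digitAccept E P m K M)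
  have h2 := h1.comp Primrec.succ
  refine primrecPred_iff_primrec_decide.1 (h2.of_eq fun n => ?_)
  rw [hQs]
  exact exists_digitAccept_iff n.succ_pos E P m hK hM

/-! ### The Local Statistics Matcher is an algorithm -/

/-- A family of trees, indexed by the states `a` of a computation, whose next action is a primitive
recursive function of the state and of the list of responses. -/
def PrimrecTree {d : ℕ} {α : Type} [Primcodable α] {N : α → ℕ} (c : ∀ a, Tree d (N a)) : Prop :=
  Primrec fun p : α × List ℕ => (c p.1).action p.2

/-- The element of `Fin n` with value `y`; values outside the range are reduced modulo `n`, so that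
the function is total. -/
def vertexOf {n : ℕ} (hn : 0 < n) (y : ℕ) : Fin n :=
  ⟨y % n, Nat.mod_lt _ hn⟩

theorem vertexOf_of_lt {n : ℕ} (hn : 0 < n) {y : ℕ} (hy : y < n) : vertexOf hn y = ⟨y, hy⟩ :=
  Fin.ext (Nat.mod_eq_of_lt hy)

theorem vertexOf_val {n : ℕ} (hn : 0 < n) (x : Fin n) : vertexOf hn x = x :=
  vertexOf_of_lt hn x.2

section

variable {d : ℕ} {α : Type} [Primcodable α] {N : α → ℕ}

theorem PrimrecTree.comp {c : ∀ a, Tree d (N a)} (hc : PrimrecTree c) {β : Type} [Primcodable β]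
    {g : β → α} (hg : Primrec g) : PrimrecTree (N := fun b => N (g b)) fun b => c (g b) :=
  Primrec.comp hc (Primrec.pair (hg.comp Primrec.fst) Primrec.snd)

theorem primrecTree_halt {v : α → Bool} (hv : Primrec v) :
    PrimrecTree (d := d) (N := N) fun a => .halt (v a) :=
  (Primrec.sumInl.comp (hv.comp Primrec.fst)).of_eq fun p => by rw [Tree.action]

theorem primrec_vertexOf (hN : Primrec N) (hpos : ∀ a, 0 < N a) :
    Primrec fun b : α × ℕ => (vertexOf (hpos b.1) b.2).val :=
  Primrec.nat_mod.comp Primrec.snd (hN.comp Primrec.fst)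

/-- The step after a draw or a query, as a function of the state and the responses. -/
theorem primrec_action_step (hN : Primrec N) (hpos : ∀ a, 0 < N a) {A : α → Tree.Action d}
    (hA : Primrec A) {c : ∀ a, Fin (N a) → Tree d (N a)}
    (hc : PrimrecTree (N := fun b : α × ℕ => N b.1) fun b => c b.1 (vertexOf (hpos b.1) b.2)) :
    Primrec fun p : α × List ℕ => List.casesOn (motive := fun _ => Tree.Action d) p.2 (A p.1)
      fun y l => if y < N p.1 then (c p.1 (vertexOf (hpos p.1) y)).action l else Sum.inl false := by
  refine Primrec.list_casesOn (h := fun (p : α × List ℕ) (q : ℕ × List ℕ) =>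
    if q.1 < N p.1 then (c p.1 (vertexOf (hpos p.1) q.1)).action q.2 else Sum.inl false)
    Primrec.snd (hA.comp Primrec.fst) ?_
  refine Primrec.ite (Primrec.nat_lt.comp (Primrec.fst.comp Primrec.snd)
    (hN.comp (Primrec.fst.comp Primrec.fst))) ?_ (Primrec.const _)
  exact Primrec.comp hc (Primrec.pair (Primrec.pair (Primrec.fst.comp Primrec.fst)
    (Primrec.fst.comp Primrec.snd)) (Primrec.snd.comp Primrec.snd))

theorem primrecTree_query (hN : Primrec N) (hpos : ∀ a, 0 < N a) (j : Fin d) (pos : Bool)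
    {x : ∀ a, Fin (N a)} (hx : Primrec fun a => (x a).val) {c : ∀ a, Fin (N a) → Tree d (N a)}
    (hc : PrimrecTree (N := fun b : α × ℕ => N b.1) fun b => c b.1 (vertexOf (hpos b.1) b.2)) :
    PrimrecTree fun a => .query j pos (x a) (c a) := by
  refine (primrec_action_step hN hpos (A := fun a => Sum.inr (Sum.inr (j, pos, (x a).val)))
    (Primrec.sumInr.comp (Primrec.sumInr.comp (Primrec.pair (Primrec.const j)
      (Primrec.pair (Primrec.const pos) hx)))) hc).of_eq ?_
  rintro ⟨a, _ | ⟨y, l⟩⟩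
  · rfl
  · simp only [Tree.action]
    split
    · rename_i hy
      rw [vertexOf_of_lt _ hy]
    · rfl

theorem primrecTree_sample (hN : Primrec N) (hpos : ∀ a, 0 < N a)
    {c : ∀ a, Fin (N a) → Tree d (N a)}
    (hc : PrimrecTree (N := fun b : α × ℕ => N b.1) fun b => c b.1 (vertexOf (hpos b.1) b.2)) :
    PrimrecTree fun a => .sample (N a) (hpos a) (c a) := by
  refine (primrec_action_step hN hpos (A := fun a => Sum.inr (Sum.inl (N a)))
    (Primrec.sumInr.comp (Primrec.sumInl.comp hN)) hc).of_eq ?_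
  rintro ⟨a, _ | ⟨y, l⟩⟩
  · rfl
  · simp only [Tree.action]
    split
    · rename_i hy
      rw [vertexOf_of_lt _ hy]
    · rfl

end

theorem primrecTree_queryWord {d : ℕ} (w : Word d) {α : Type} [Primcodable α] {N : α → ℕ}
    (hN : Primrec N) (hpos : ∀ a, 0 < N a) {x : ∀ a, Fin (N a)} (hx : Primrec fun a => (x a).val)
    {c : ∀ a, Fin (N a) → Tree d (N a)}
    (hc : PrimrecTree (N := fun b : α × ℕ => N b.1) fun b => c b.1 (vertexOf (hpos b.1) b.2)) :
    PrimrecTree fun a => queryWord w (x a) (c a) := by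
  induction w generalizing c with
  | nil =>
    have h := hc.comp (Primrec.pair Primrec.id hx)
    simp only [id, vertexOf_val] at h
    exact h
  | cons l w ih =>
    refine ih (c := fun a y => .query l.1 l.2 y (c a)) ?_
    exact primrecTree_query (α := α × ℕ) (hN.comp Primrec.fst) (fun b => hpos b.1) l.1 l.2
      (primrec_vertexOf hN hpos) (c := fun b => c b.1)
      (hc.comp (Primrec.pair (Primrec.fst.comp Primrec.fst) Primrec.snd))

/-- The set computed by `queryStab` takes finitely many values, so it suffices that the
continuation is primitive recursive for each of them separately. -/
theorem primrecTree_queryStab {d : ℕ} (ws : List (FS d)) {α : Type} [Primcodable α] {N : α → ℕ}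
    (hN : Primrec N) (hpos : ∀ a, 0 < N a) {x : ∀ a, Fin (N a)} (hx : Primrec fun a => (x a).val)
    {c : ∀ a, Finset (FS d) → Tree d (N a)} (hc : ∀ Q, PrimrecTree fun a => c a Q) :
    PrimrecTree fun a => queryStab ws (x a) (c a) := by
  induction ws generalizing α with
  | nil => exact hc ∅
  | cons w ws ih =>
    refine primrecTree_queryWord w.toWord hN hpos hx (c := fun a y => queryStab ws (x a) fun Q =>
      c a (if y = x a then insert w Q else Q)) ?_
    refine ih (α := α × ℕ) (hN.comp Primrec.fst) (fun b => hpos b.1) (x := fun b => x b.1)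
      (hx.comp Primrec.fst)
      (c := fun b Q => c b.1 (if vertexOf (hpos b.1) b.2 = x b.1 then insert w Q else Q))
      fun Q => ?_
    have heq : PrimrecPred fun p : (α × ℕ) × List ℕ => vertexOf (hpos p.1.1) p.1.2 = x p.1.1 :=
      (Primrec.eq.comp ((primrec_vertexOf hN hpos).comp Primrec.fst)
        (hx.comp (Primrec.fst.comp Primrec.fst))).of_eq fun p => Fin.ext_iff.symm
    refine (Primrec.ite heq ((hc (insert w Q)).comp Primrec.fst) ((hc Q).comp Primrec.fst)).of_eq
      fun p => ?_
    dsimp only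
    split <;> rfl

theorem primrecTree_queryStabs {d : ℕ} (P : Finset (FS d)) {α : Type} [Primcodable α] {N : α → ℕ}
    (hN : Primrec N) (hpos : ∀ a, 0 < N a) (xs : List (∀ a, Fin (N a)))
    (hxs : ∀ x ∈ xs, Primrec fun a => (x a).val) {c : ∀ a, List (Finset (FS d)) → Tree d (N a)}
    (hc : ∀ Qs, PrimrecTree fun a => c a Qs) :
    PrimrecTree fun a => queryStabs P (xs.map fun x => x a) (c a) := by
  induction xs generalizing c with
  | nil => exact hc []
  | cons x xs ih =>
    refine primrecTree_queryStab P.toList hN hpos (hxs x List.mem_cons_self)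
      (c := fun a Q => queryStabs P (xs.map fun x => x a) fun Qs => c a (Q :: Qs)) fun Q => ?_
    exact ih (fun y hy => hxs y (List.mem_cons_of_mem x hy)) fun Qs => hc (Q :: Qs)

/-- The draws enlarge the state; the hypothesis therefore allows the state to be extended by any
further data `b` from which the drawn elements are computed. -/
theorem primrecTree_sampleMany {d : ℕ} (k : ℕ) {α : Type} [Primcodable α] {N : α → ℕ}
    (hN : Primrec N) (hpos : ∀ a, 0 < N a) {c : ∀ a, List (Fin (N a)) → Tree d (N a)}
    (hc : ∀ (β : Type) [Primcodable β] (g : β → α), Primrec g →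
      ∀ xs : List (∀ b, Fin (N (g b))), (∀ x ∈ xs, Primrec fun b => (x b).val) →
        PrimrecTree (N := fun b => N (g b)) fun b => c (g b) (xs.map fun x => x b)) :
    PrimrecTree fun a => sampleMany (hpos a) k (c a) := by
  induction k generalizing α with
  | zero => exact hc α id Primrec.id [] (by simp)
  | succ k ih =>
    refine primrecTree_sample hN hpos
      (c := fun a x => sampleMany (hpos a) k fun xs => c a (x :: xs)) ?_
    refine ih (α := α × ℕ) (hN.comp Primrec.fst) (fun b => hpos b.1)
      (c := fun b xs => c b.1 (vertexOf (hpos b.1) b.2 :: xs)) ?_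
    intro β _ g hg xs hxs
    refine hc β (fun b => (g b).1) (Primrec.fst.comp hg)
      ((fun b => vertexOf (hpos (g b).1) (g b).2) :: xs) ?_
    intro x hx
    rcases List.mem_cons.1 hx with rfl | hx
    · exact (primrec_vertexOf hN hpos).comp hg
    · exact hxs x hx

theorem isAlgorithm_LSM {d : ℕ} (E : EqSystem d) (k : ℕ) (P : Finset (FS d)) {M : ℕ}
    (hM : 0 < M) : (LSM E k P (1 / (M : ℝ))).IsAlgorithm := by
  classical
  have hsucc : PrimrecTree fun n : ℕ => LSM E k P (1 / (M : ℝ)) (n + 1) := by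
    have h := primrecTree_sampleMany (d := d) k (N := fun n : ℕ => n + 1) Primrec.succ
      (fun n => n.succ_pos) (c := fun n xs => queryStabs P xs fun Qs =>
        .halt (decide (∃ τ ∈ Sol E (n + 1),
          dTV P.powerset (uniformLaw Qs.get) (localStat τ P) ≤ 1 / (M : ℝ)))) ?_
    · refine Primrec.of_eq h fun p => ?_
      simp only [LSM, dif_pos (Nat.succ_pos _)]
    · intro β _ g hg xs hxs
      refine primrecTree_queryStabs P (Primrec.succ.comp hg) (fun b => (g b).succ_pos) xs hxs
        fun Qs => primrecTree_halt ?_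
      convert (primrec_verdict E P hM Qs).comp hg
  refine Primrec.to_comp ?_
  refine (Primrec.nat_casesOn (f := fun p : ℕ × List ℕ => p.1) (g := fun _ => Sum.inl false)
    (h := fun p n => (LSM E k P (1 / (M : ℝ)) (n + 1)).action p.2) Primrec.fst (Primrec.const _)
    ?_).of_eq ?_
  · exact Primrec.comp hsucc (Primrec.pair Primrec.snd (Primrec.snd.comp Primrec.fst))
  · rintro ⟨_ | n, l⟩
    · change Sum.inl false = (LSM E k P (1 / (M : ℝ)) 0).action l
      simp only [LSM, lt_irrefl, dite_false, Tree.action]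
    · rfl

/-- For a statistically distinguishable system suitable Local Statistics Matchers are testers. -/
theorem StatisticallyDistinguishable.exists_isTester_LSM {d : ℕ} {E : EqSystem d}
    (h : StatisticallyDistinguishable E) {ε : ℝ} (hε : 0 < ε) :
    ∃ (k : ℕ) (P : Finset (FS d)) (δ : ℝ), (0 < k ∧ 0 < δ) ∧ ∃ q, IsTester E ε q (LSM E k P δ) := by
  obtain ⟨P, δ₀, hδ₀, hdist⟩ := h ε hε
  -- The proximity parameter is rational, so that distances can be compared with it exactly.
  obtain ⟨M, hM⟩ := exists_nat_gt (3 / δ₀)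
  have hM0 : (0 : ℝ) < M := (by positivity : 0 < 3 / δ₀).trans hM
  have hδ : (0 : ℝ) < 1 / M := by positivity
  obtain ⟨k, hk⟩ := exists_nat_gt (25 * (P.powerset.card : ℝ) ^ 2 / (1 / (M : ℝ)) ^ 2)
  have hk0 : 0 < k := by
    have : (0 : ℝ) < k := lt_of_le_of_lt (by positivity) hk
    exact_mod_cast this
  refine ⟨k, P, 1 / M, ⟨hk0, hδ⟩, _, isTester_LSM hdist hδ ?_ hk0 ?_
    (isAlgorithm_LSM E k P (Nat.cast_pos.1 hM0))⟩
  · rw [div_lt_iff₀ hδ₀] at hM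
    rw [mul_one_div, div_le_iff₀ hM0]
    linarith
  · exact ((div_lt_iff₀ (by positivity)).1 hk).le

end PermEq

theorem theorem1p9 (d : ℕ) (E : PermEq.EqSystem d) :
    List.TFAE
      [PermEq.Testable E,
       ∃ (k : ℝ → ℕ) (P : ℝ → Finset (PermEq.FS d)) (δ : ℝ → ℝ),
         (∀ ε : ℝ, 0 < ε → 0 < k ε ∧ 0 < δ ε) ∧
         PermEq.IsFamilyOfTesters E (fun ε => PermEq.LSM E (k ε) (P ε) (δ ε)),
       PermEq.StatisticallyDistinguishable E] := by
  tfae_have 1 → 3 := PermEq.Testable.statisticallyDistinguishable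
  tfae_have 3 → 2 := by
    intro h
    choose! k P δ hpos htester using fun ε (hε : 0 < ε) => h.exists_isTester_LSM hε
    exact ⟨k, P, δ, hpos, htester⟩
  tfae_have 2 → 1 := by
    rintro ⟨k, P, δ, -, h⟩ ε hε
    obtain ⟨q, hq⟩ := h ε hε
    exact ⟨q, _, hq⟩
  tfae_finish
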